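/- Let $\mathcal S_d$ be the set of density matrices on $\mathbb C^d$ (positive semidefinite $d\times d$ complex matrices of trace $1$). For $\rho,\sigma\in\mathcal S_d$ define the following quantities. - The Uhlmann fidelity $F(\rho,\sigma)=\operatorname{tr}\sqrt{\sqrt\sigma\,\rho\,\sqrt\sigma}$. - $F_{\min}(\rho,\sigma)=\sup\sum_x\sqrt{p(x)q(x)}$, where the supremum is over all reverse tests of $\{\rho,\sigma\}$, that is, all completely positive trace preserving maps $\Phi$ and probability distributions $p,q$ on a finite set (of any size), regarded as diagonal density matrices, with $\Phi(p)=\rho$ and $\Phi(q)=\sigma$. - $F_R(\rho,\sigma)=\cos d_R(\rho,\sigma)$ with $d_R(\rho,\sigma)=\inf_{\{\rho_t\}}\frac12\int_0^1\sqrt{J^R_t}\,dt$, where the infimum is over all smooth paths $[0,1]\ni t\mapsto\rho_t\in\mathcal S_d$ with $\rho_0=\rho$ and $\rho_1=\sigma$, and $J^R_t=\operatorname{tr}L_t^\dagger L_t\rho_t$ is the RLD (right logarithmic derivative) Fisher information, $L_t$ being a solution of $\frac{d\rho_t}{dt}=L_t\rho_t$ (the value does not depend on the solution; $J^R_t=\infty$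 if there is none). Then: 1. For all $\rho,\sigma\in\mathcal S_d$, $d_R(\rho,\sigma)<\infty$ and $$F_{\min}(\rho,\sigma)\le F_R(\rho,\sigma)\le F(\rho,\sigma).$$ 2. $F_R$ satisfies the triangle inequality: for all $\rho,\sigma,\tau\in\mathcal S_d$, $$\cos^{-1}F_R(\rho,\sigma)\le\cos^{-1}F_R(\rho,\tau)+\cos^{-1}F_R(\tau,\sigma).$$ 3. If $d\ge2$, then $F_{\min}$ does not satisfy it: there are $\rho,\sigma,\tau\in\mathcal S_d$ with $$\cos^{-1}F_{\min}(\rho,\sigma)>\cos^{-1}F_{\min}(\rho,\tau)+\cos^{-1}F_{\min}(\tau,\sigma).$$ 4. If $d\ge2$, then $F_{\min}$ and $F_R$ do not coincide: there are $\rho,\sigma\in\mathcal S_d$ with $F_{\min}(\rho,\sigma)\ne F_R(\rho,\sigma)$. -/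

import Mathlib

open scoped ENNReal ContDiff ComplexOrder MatrixOrder

noncomputable section

namespace QFidelity

/-- Density matrices (quantum states) on `ℂ^n`. -/
def IsState {n : Type*} [Fintype n] (ρ : Matrix n n ℂ) : Prop :=
  ρ.PosSemidef ∧ ρ.trace = 1

/-- The map `Φ ⊗ id_k` on matrices with index set `m × Fin k`. -/
def ampliation {m n : Type*} (Φ : Matrix m m ℂ →ₗ[ℂ] Matrix n n ℂ) (k : ℕ)
    (A : Matrix (m × Fin k) (m × Fin k) ℂ) : Matrix (n × Fin k) (n × Fin k) ℂ :=
  Matrix.of fun i j => Φ (Matrix.of fun a b => A (a, i.2) (b, j.2)) i.1 j.1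

/-- Completely positive trace preserving maps. -/
def IsCPTP {m n : Type*} [Fintype m] [Fintype n]
    (Φ : Matrix m m ℂ →ₗ[ℂ] Matrix n n ℂ) : Prop :=
  (∀ (k : ℕ) (A : Matrix (m × Fin k) (m × Fin k) ℂ),
      A.PosSemidef → (ampliation Φ k A).PosSemidef) ∧
    ∀ A : Matrix m m ℂ, (Φ A).trace = A.trace

/-- A probability distribution (or any real function) as a diagonal matrix. -/
def diagState {X : Type*} [DecidableEq X] (p : X → ℝ) : Matrix X X ℂ :=
  Matrix.diagonal fun x => (p x : ℂ)

/-- `(Φ, {p, q})` is a reverse test of `{ρ, σ}`. -/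
structure IsReverseTest {X n : Type*} [Fintype X] [DecidableEq X] [Fintype n]
    (Φ : Matrix X X ℂ →ₗ[ℂ] Matrix n n ℂ) (p q : X → ℝ) (ρ σ : Matrix n n ℂ) : Prop where
  cptp : IsCPTP Φ
  prob_left : p ∈ stdSimplex ℝ X
  prob_right : q ∈ stdSimplex ℝ X
  map_left : Φ (diagState p) = ρ
  map_right : Φ (diagState q) = σ

/-- Classical fidelity. -/
def classicalFidelity {X : Type*} [Fintype X] (p q : X → ℝ) : ℝ :=
  ∑ x, √(p x) * √(q x)

/-- Uhlmann fidelity `F(ρ, σ) = tr √(√σ ρ √σ)`. -/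
def fidelity {n : Type*} [Fintype n] [DecidableEq n] (ρ σ : Matrix n n ℂ) : ℝ :=
  (CFC.sqrt (CFC.sqrt σ * ρ * CFC.sqrt σ)).trace.re

/-- `F_min(ρ, σ)`: the supremum of the classical fidelity over all reverse tests, on finite sets
of arbitrary size. -/
def Fmin {n : Type*} [Fintype n] (ρ σ : Matrix n n ℂ) : ℝ :=
  sSup {x : ℝ | ∃ (k : ℕ) (Φ : Matrix (Fin k) (Fin k) ℂ →ₗ[ℂ] Matrix n n ℂ) (p q : Fin k → ℝ),
    IsReverseTest Φ p q ρ σ ∧ x = classicalFidelity p q}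

/-- RLD Fisher information at the point `ρ` in the direction `D`: the number `tr L† L ρ` where
`D = L ρ`. For singular `ρ` the solution `L` need not be unique, but `tr L† L ρ` does not depend
on it; if there is no solution, the value is `∞`. -/
def rldFisher {n : Type*} [Fintype n] (ρ D : Matrix n n ℂ) : ℝ≥0∞ :=
  ⨅ (L : Matrix n n ℂ) (_ : D = L * ρ),
    ENNReal.ofReal (L.conjTranspose * L * ρ).trace.re

/-- Velocity of a curve parametrized by `[0, 1]` (one-sided at the end points). -/
def velocity {n : Type*} (γ : ℝ → Matrix n n ℂ) (t : ℝ) : Matrix n n ℂ :=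
  Matrix.of fun i j => derivWithin (fun s => γ s i j) (Set.Icc 0 1) t

/-- Smooth paths `[0, 1] → S(ℂ^n)` from `ρ` to `σ`. Values outside `[0, 1]` are irrelevant. -/
structure IsSmoothPath {n : Type*} [Fintype n] (γ : ℝ → Matrix n n ℂ)
    (ρ σ : Matrix n n ℂ) : Prop where
  smooth : ∀ i j, ContDiffOn ℝ ∞ (fun t => γ t i j) (Set.Icc 0 1)
  state : ∀ t ∈ Set.Icc (0 : ℝ) 1, IsState (γ t)
  source : γ 0 = ρ
  target : γ 1 = σ

/-- `(1/2) ∫ √(J^R_t) dt` along the path. -/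
def rldLength {n : Type*} [Fintype n] (γ : ℝ → Matrix n n ℂ) : ℝ≥0∞ :=
  2⁻¹ * ∫⁻ t in Set.Icc (0 : ℝ) 1, rldFisher (γ t) (velocity γ t) ^ (1 / 2 : ℝ)

/-- Geodesic distance for the RLD metric: infimum of the lengths of all smooth paths. -/
def rldDist {n : Type*} [Fintype n] (ρ σ : Matrix n n ℂ) : ℝ≥0∞ :=
  ⨅ (γ : ℝ → Matrix n n ℂ) (_ : IsSmoothPath γ ρ σ), rldLength γ

/-- The RLD-geodesic fidelity. -/
def FR {n : Type*} [Fintype n] (ρ σ : Matrix n n ℂ) : ℝ :=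
  Real.cos (rldDist ρ σ).toReal

end QFidelity

end

/-! Lower bound for `FR`: on diagonal inputs a channel only prepares states `S x` with weights `p x`
or `q x` (`map_diagState`). Moving `√p` to `√q` along a great circle gives a path of mixtures. Joint
convexity bounds its RLD information by the classical Fisher information of the weights
(`rldFisher_sum_le`), so its length is at most `arccos (∑ √p √q)` (`rldDist_mixture_le`). This gives
`Fmin ≤ FR`; preparing the two end states outright gives `rldDist ≤ π / 2`.

Upper bound for `FR`: no path is shorter than the Bures angle. If the states are invertible and `M`
transports `γ t` to the target, Alberti's inequality puts an affine function of the state, with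
linear part `re tr (· M) / 2`, above the fidelity and touching it at `γ t`. So fidelity grows no
faster than this function, and Cauchy–Schwarz bounds the rate by `(1/2) √J √(1 - F²)`. A comparison
with cosines integrates this (`arccos_le_integral_of_slope_le`). Singular paths are mixed with a
full-rank state, which does not increase the information, and the mixing weight tends to 0.

The triangle inequality for `FR` comes from concatenating paths; since distances are at most `π /
2`, `arccos` undoes the cosine. For `Fmin` it fails: two distinct pure states share no component, so
`Fmin` vanishes, yet both occur with weight `25/49` in one mixture `τ`, at angle less than `π / 4`
from each. If `Fmin` and `FR` coincided, this would contradict the triangle inequality for `FR`. -/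

namespace QFidelity

/-! ### Convexity and scaling of the RLD Fisher information. -/

section Algebra

variable {n ι : Type*} [Fintype n] [Fintype ι]

theorem re_trace_mul_mul_conjTranspose_nonneg {A : Matrix n n ℂ} (hA : A.PosSemidef)
    (X : Matrix n n ℂ) : 0 ≤ (X * A * X.conjTranspose).trace.re :=
  (Complex.nonneg_iff.1 (hA.mul_mul_conjTranspose_same X).trace_nonneg).1

theorem re_trace_conjTranspose (X : Matrix n n ℂ) : X.conjTranspose.trace.re = X.trace.re := by
  rw [Matrix.trace_conjTranspose]; simp

theorem re_trace_conjTranspose_mul_mul (L ρ : Matrix n n ℂ) :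
    (L.conjTranspose * L * ρ).trace.re = (L * ρ * L.conjTranspose).trace.re := by
  rw [Matrix.mul_assoc, Matrix.trace_mul_comm]

/-- Cauchy–Schwarz for the semi-inner product weighted by `γ`: the quadratic `r ↦ re tr ((X - rY) γ
(X - rY)†)` is nonnegative, so its discriminant is at most 0. -/
theorem re_trace_mul_mul_sq_le {γ : Matrix n n ℂ} (hγ : γ.PosSemidef) (X Y : Matrix n n ℂ) :
    (X * γ * Y.conjTranspose).trace.re ^ 2 ≤
      (X * γ * X.conjTranspose).trace.re * (Y * γ * Y.conjTranspose).trace.re := by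
  have h : ∀ r : ℝ, 0 ≤ (Y * γ * Y.conjTranspose).trace.re * (r * r)
      + (-2 * (X * γ * Y.conjTranspose).trace.re) * r + (X * γ * X.conjTranspose).trace.re := by
    intro r
    have h1 := re_trace_mul_mul_conjTranspose_nonneg hγ (X - (r : ℂ) • Y)
    have h2 : (Y * γ * X.conjTranspose).trace.re = (X * γ * Y.conjTranspose).trace.re := by
      rw [← re_trace_conjTranspose]
      simp [Matrix.conjTranspose_mul, hγ.isHermitian.eq, Matrix.mul_assoc]
    simp only [Matrix.conjTranspose_sub, Matrix.conjTranspose_smul, Matrix.sub_mul, Matrix.mul_sub,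
      Matrix.smul_mul, Matrix.mul_smul, Matrix.trace_sub, Matrix.trace_smul, Complex.sub_re,
      smul_eq_mul, Complex.star_def, Complex.conj_ofReal, Complex.re_ofReal_mul, h2] at h1
    linarith
  have h3 := discrim_le_zero h
  rw [discrim] at h3
  linarith

/-- Joint convexity of the RLD Fisher information, in terms of logarithmic derivatives. -/
theorem re_trace_le_sum_of_mul_sum_eq {R K : ι → Matrix n n ℂ} (hR : ∀ x, (R x).PosSemidef)
    {L : Matrix n n ℂ} (h : L * ∑ x, R x = ∑ x, K x * R x) :
    (L.conjTranspose * L * ∑ x, R x).trace.re ≤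
      ∑ x, ((K x).conjTranspose * K x * R x).trace.re := by
  have key : ∀ x, 0 ≤ (L * R x * L.conjTranspose).trace.re
      - 2 * (K x * R x * L.conjTranspose).trace.re
      + (K x * R x * (K x).conjTranspose).trace.re := by
    intro x
    have h1 := re_trace_mul_mul_conjTranspose_nonneg (hR x) (L - K x)
    have h2 : (L * R x * (K x).conjTranspose).trace.re
        = (K x * R x * L.conjTranspose).trace.re := by
      rw [← re_trace_conjTranspose]
      simp [Matrix.conjTranspose_mul, (hR x).isHermitian.eq, Matrix.mul_assoc]
    simp only [Matrix.conjTranspose_sub, Matrix.sub_mul, Matrix.mul_sub, Matrix.trace_sub,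
      Complex.sub_re, h2] at h1
    linarith
  have hsum := Finset.sum_nonneg fun x (_ : x ∈ Finset.univ) => key x
  have hL : ∑ x, (L * R x * L.conjTranspose).trace.re
      = (L * (∑ x, R x) * L.conjTranspose).trace.re := by
    simp only [Matrix.mul_sum, Matrix.sum_mul, Matrix.trace_sum, Complex.re_sum]
  -- The hypothesis `h` turns the cross terms into the quadratic term of `L`, so of `key` summed
  -- over `x` only the difference of the two sides remains.
  have hK : ∑ x, (K x * R x * L.conjTranspose).trace.re
      = (L * (∑ x, R x) * L.conjTranspose).trace.re := by
    rw [h]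
    simp only [Matrix.sum_mul, Matrix.trace_sum, Complex.re_sum]
  simp only [re_trace_conjTranspose_mul_mul]
  rw [Finset.sum_add_distrib, Finset.sum_sub_distrib, ← Finset.mul_sum, hL, hK] at hsum
  linarith

/-- A matrix whose kernel contains that of `A` is a left multiple of `A`. -/
theorem exists_eq_mul_of_mulVec_eq_zero (A D : Matrix n n ℂ)
    (h : ∀ v, A.mulVec v = 0 → D.mulVec v = 0) : ∃ L : Matrix n n ℂ, D = L * A := by
  classical
  have hker : A.mulVecLin.ker ≤ D.mulVecLin.ker := fun v hv => by
    simpa using h v (by simpa using hv)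
  obtain ⟨g, hg⟩ := LinearMap.exists_extend
    ((A.mulVecLin.ker.liftQ D.mulVecLin hker) ∘ₗ
      A.mulVecLin.quotKerEquivRange.symm.toLinearMap)
  refine ⟨LinearMap.toMatrix' g, ?_⟩
  have h2 : D.mulVecLin = g ∘ₗ A.mulVecLin := by
    refine LinearMap.ext fun v => ?_
    have := LinearMap.congr_fun hg (A.mulVecLin.rangeRestrict v)
    refine Eq.trans ?_ this.symm
    rw [LinearMap.coe_comp, Function.comp_apply, LinearEquiv.coe_coe]
    have h3 : A.mulVecLin.quotKerEquivRange.symm (A.mulVecLin.rangeRestrict v)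
        = Submodule.Quotient.mk v := by
      rw [LinearEquiv.symm_apply_eq]
      rfl
    rw [h3]
    rfl
  have h3 := congrArg LinearMap.toMatrix' h2
  rw [LinearMap.toMatrix'_comp] at h3
  simpa [← Matrix.toLin'_apply'] using h3

theorem mulVec_eq_zero_of_sum_mulVec_eq_zero {R : ι → Matrix n n ℂ}
    (hR : ∀ x, (R x).PosSemidef) {v : n → ℂ} (hv : (∑ x, R x).mulVec v = 0) (x : ι) :
    (R x).mulVec v = 0 := by
  rw [← (hR x).dotProduct_mulVec_zero_iff]
  have h : ∑ x, dotProduct (star v) ((R x).mulVec v) = 0 := by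
    rw [← dotProduct_sum, ← Matrix.sum_mulVec, hv, dotProduct_zero]
  exact (Finset.sum_eq_zero_iff_of_nonneg
    fun x _ => (hR x).dotProduct_mulVec_nonneg v).1 h x (Finset.mem_univ x)

/-- The RLD Fisher information of a mixture is at most the classical Fisher information of the
weights. -/
theorem rldFisher_sum_le {R : ι → Matrix n n ℂ} (hR : ∀ x, (R x).PosSemidef) (l : ι → ℝ) :
    rldFisher (∑ x, R x) (∑ x, (l x : ℂ) • R x) ≤
      ENNReal.ofReal (∑ x, l x ^ 2 * (R x).trace.re) := by
  classical
  obtain ⟨L, hL⟩ := exists_eq_mul_of_mulVec_eq_zero (∑ x, R x) (∑ x, (l x : ℂ) • R x) (by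
    intro v hv
    rw [Matrix.sum_mulVec]
    refine Finset.sum_eq_zero fun x _ => ?_
    rw [Matrix.smul_mulVec, mulVec_eq_zero_of_sum_mulVec_eq_zero hR hv x, smul_zero])
  refine iInf₂_le_of_le L hL (ENNReal.ofReal_le_ofReal ?_)
  refine (re_trace_le_sum_of_mul_sum_eq (K := fun x => (l x : ℂ) • 1) hR
    (by simpa using hL.symm)).trans (le_of_eq (Finset.sum_congr rfl fun x _ => ?_))
  simp [Matrix.conjTranspose_smul, sq, mul_assoc]

theorem rldFisher_smul_le (ρ D : Matrix n n ℂ) (c : ℝ) :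
    rldFisher ρ ((c : ℂ) • D) ≤ ENNReal.ofReal (c ^ 2) * rldFisher ρ D := by
  -- Zero cannot be moved inside the infimum, which is `∞` when there is no logarithmic derivative.
  rcases eq_or_ne c 0 with rfl | hc
  · refine (iInf₂_le_of_le 0 (by simp) ?_ : _ ≤ (0 : ℝ≥0∞)).trans bot_le
    simp
  have hc' : ENNReal.ofReal (c ^ 2) ≠ 0 := by
    simpa using hc
  unfold rldFisher
  rw [ENNReal.mul_iInf_of_ne hc' ENNReal.ofReal_ne_top]
  refine le_iInf fun L => ?_
  rw [ENNReal.mul_iInf_of_ne hc' ENNReal.ofReal_ne_top]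
  refine le_iInf fun hL => ?_
  refine iInf₂_le_of_le ((c : ℂ) • L) (by rw [hL, Matrix.smul_mul]) ?_
  rw [← ENNReal.ofReal_mul (sq_nonneg c)]
  refine ENNReal.ofReal_le_ofReal (le_of_eq ?_)
  simp [Matrix.conjTranspose_smul, sq, mul_assoc]

end Algebra

/-! ### Great-circle paths and upper bounds on the distance. -/

section UpperBound

variable {n ι : Type*} [Fintype n] [Fintype ι]

theorem IsState.trace_re {ρ : Matrix n n ℂ} (h : IsState ρ) : ρ.trace.re = 1 := by
  rw [h.2, Complex.one_re]

theorem velocity_eq_of_hasDerivWithinAt {m : Type*} {γ : ℝ → Matrix m m ℂ} {t : ℝ}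
    {D : Matrix m m ℂ}
    (ht : t ∈ Set.Icc (0 : ℝ) 1)
    (h : ∀ i j, HasDerivWithinAt (fun s => γ s i j) (D i j) (Set.Icc 0 1) t) :
    velocity γ t = D := by
  ext i j
  exact (h i j).derivWithin (uniqueDiffOn_Icc zero_lt_one t ht)

theorem rldFisher_zero (ρ : Matrix n n ℂ) : rldFisher ρ 0 = 0 := by
  refine le_antisymm (iInf₂_le_of_le 0 (by simp) ?_) bot_le
  simp

theorem rldDist_self {ρ : Matrix n n ℂ} (hρ : IsState ρ) : rldDist ρ ρ = 0 := by
  have hp : IsSmoothPath (fun _ => ρ) ρ ρ :=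
    ⟨fun i j => contDiffOn_const, fun _ _ => hρ, rfl, rfl⟩
  refine le_antisymm (iInf₂_le_of_le _ hp ?_) bot_le
  have hv : ∀ t, velocity (fun _ => ρ) t = 0 := fun t => by
    ext i j
    simp [velocity]
  simp [rldLength, hv, rldFisher_zero]

theorem rldLength_le_of_rldFisher_le {γ : ℝ → Matrix n n ℂ} {θ : ℝ} (hθ : 0 ≤ θ)
    (h : ∀ t ∈ Set.Icc (0 : ℝ) 1,
      rldFisher (γ t) (velocity γ t) ≤ ENNReal.ofReal ((2 * θ) ^ 2)) :
    rldLength γ ≤ ENNReal.ofReal θ := by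
  have h1 : ∀ t ∈ Set.Icc (0 : ℝ) 1,
      rldFisher (γ t) (velocity γ t) ^ (1 / 2 : ℝ) ≤ ENNReal.ofReal (2 * θ) := by
    intro t ht
    refine (ENNReal.rpow_le_rpow (h t ht) (by norm_num)).trans (le_of_eq ?_)
    rw [ENNReal.ofReal_rpow_of_nonneg (by positivity) (by norm_num), ← Real.sqrt_eq_rpow,
      Real.sqrt_sq (by positivity)]
  have h2 : ∫⁻ t in Set.Icc (0 : ℝ) 1, rldFisher (γ t) (velocity γ t) ^ (1 / 2 : ℝ)
      ≤ ENNReal.ofReal (2 * θ) := by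
    refine (MeasureTheory.setLIntegral_mono measurable_const h1).trans ?_
    simp
  refine (mul_le_mul_right h2 _).trans (le_of_eq ?_)
  rw [ENNReal.ofReal_mul (by norm_num), ← mul_assoc, ENNReal.ofReal_ofNat,
    ENNReal.inv_mul_cancel (by norm_num) (by norm_num), one_mul]

theorem isState_sum {S : ι → Matrix n n ℂ} (hS : ∀ x, IsState (S x)) {p : ι → ℝ}
    (hp : ∀ x, 0 ≤ p x) (hp1 : ∑ x, p x = 1) : IsState (∑ x, (p x : ℂ) • S x) := by
  refine ⟨Matrix.posSemidef_sum _ fun x _ =>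
    (hS x).1.smul (by exact_mod_cast hp x), ?_⟩
  simp only [Matrix.trace_sum, Matrix.trace_smul, (hS _).2, smul_eq_mul, mul_one]
  exact_mod_cast hp1

/-- The path obtained by preparing the states `S x` along a great circle of square roots of
probability distributions. -/
theorem rldDist_greatCircle_le {S : ι → Matrix n n ℂ} (hS : ∀ x, IsState (S x)) {u w : ι → ℝ}
    (hu : ∑ x, u x ^ 2 = 1) (hw : ∑ x, w x ^ 2 = 1) (huw : ∑ x, u x * w x = 0)
    {θ : ℝ} (hθ : 0 ≤ θ) :
    rldDist (∑ x, ((u x ^ 2 : ℝ) : ℂ) • S x)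
      (∑ x, (((Real.cos θ * u x + Real.sin θ * w x) ^ 2 : ℝ) : ℂ) • S x) ≤ ENNReal.ofReal θ := by
  -- `a` is the point on the circle and `b` its velocity, of norm `θ`. The weights are `a ^ 2`,
  -- smooth even where `a` changes sign, with classical Fisher information `4 ∑ b ^ 2 = (2 * θ) ^
  -- 2`.
  set a : ι → ℝ → ℝ := fun x t => Real.cos (θ * t) * u x + Real.sin (θ * t) * w x with ha
  set b : ι → ℝ → ℝ := fun x t => θ * (-Real.sin (θ * t) * u x + Real.cos (θ * t) * w x) with hb
  have hab : ∀ x t, HasDerivAt (a x) (b x t) t := by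
    intro x t
    have h0 : HasDerivAt (fun t => θ * t) θ t := by simpa using (hasDerivAt_id t).const_mul θ
    refine ((h0.cos.mul_const (u x)).add (h0.sin.mul_const (w x))).congr_deriv ?_
    simp only [hb]; ring
  have ha1 : ∀ t, ∑ x, a x t ^ 2 = 1 := by
    intro t
    have : ∀ x, a x t ^ 2 = Real.cos (θ * t) ^ 2 * u x ^ 2 + Real.sin (θ * t) ^ 2 * w x ^ 2
        + 2 * Real.cos (θ * t) * Real.sin (θ * t) * (u x * w x) := fun x => by
      simp only [ha]; ring
    simp only [this, Finset.sum_add_distrib, ← Finset.mul_sum, hu, hw, huw]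
    linarith [Real.sin_sq_add_cos_sq (θ * t)]
  have hb1 : ∀ t, ∑ x, b x t ^ 2 = θ ^ 2 := by
    intro t
    have : ∀ x, b x t ^ 2 = θ ^ 2 * (Real.sin (θ * t) ^ 2 * u x ^ 2
        + Real.cos (θ * t) ^ 2 * w x ^ 2
        - 2 * Real.cos (θ * t) * Real.sin (θ * t) * (u x * w x)) := fun x => by
      simp only [hb]; ring
    simp only [this, Finset.sum_add_distrib, Finset.sum_sub_distrib, ← Finset.mul_sum, hu, hw, huw]
    linear_combination θ ^ 2 * Real.sin_sq_add_cos_sq (θ * t)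
  set γ : ℝ → Matrix n n ℂ := fun t => ∑ x, ((a x t ^ 2 : ℝ) : ℂ) • S x with hγ
  have hγ_apply : ∀ t i j, γ t i j = ∑ x, ((a x t ^ 2 : ℝ) : ℂ) * S x i j := by
    intro t i j
    simp [hγ, Matrix.sum_apply]
  have ha_smooth : ∀ x, ContDiff ℝ ∞ (a x) := by
    intro x
    simp only [ha]
    fun_prop
  have hpath : IsSmoothPath γ (∑ x, ((u x ^ 2 : ℝ) : ℂ) • S x)
      (∑ x, (((Real.cos θ * u x + Real.sin θ * w x) ^ 2 : ℝ) : ℂ) • S x) := by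
    refine ⟨fun i j => ?_, fun t _ => isState_sum hS (fun x => sq_nonneg _) (ha1 t), ?_, ?_⟩
    · simp only [hγ_apply]
      refine ContDiff.contDiffOn (ContDiff.sum fun x _ => ?_)
      exact (Complex.ofRealCLM.contDiff.comp ((ha_smooth x).pow 2)).mul contDiff_const
    · simp [hγ, ha]
    · simp [hγ, ha]
  refine iInf₂_le_of_le γ hpath (rldLength_le_of_rldFisher_le hθ fun t ht => ?_)
  -- Where `a x t = 0` the quotient is 0 by convention; this is harmless, since the derivative `2ab`
  -- of the weight vanishes there too.
  have hvel : velocity γ t = ∑ x, ((2 * b x t / a x t : ℝ) : ℂ) • (((a x t ^ 2 : ℝ) : ℂ) • S x) := by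
    refine velocity_eq_of_hasDerivWithinAt ht fun i j => HasDerivAt.hasDerivWithinAt ?_
    simp only [hγ_apply]
    simp only [Matrix.sum_apply, Matrix.smul_apply, smul_eq_mul]
    refine HasDerivAt.fun_sum fun x _ => ?_
    have h1 := (((hab x t).pow 2).ofReal_comp).mul_const (S x i j)
    refine h1.congr_deriv ?_
    have h2 : ((2 : ℕ) : ℝ) * a x t ^ (2 - 1) * b x t = 2 * b x t / a x t * a x t ^ 2 := by
      rcases eq_or_ne (a x t) 0 with h | h
      · simp [h]
      · field_simp
        norm_num
        ring
    rw [h2, Complex.ofReal_mul, mul_assoc]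
  rw [hvel]
  refine (rldFisher_sum_le (fun x => (hS x).1.smul (by exact_mod_cast sq_nonneg (a x t))) _).trans
    (ENNReal.ofReal_le_ofReal ?_)
  have h4 : (2 * θ) ^ 2 = ∑ x, 4 * b x t ^ 2 := by
    rw [← Finset.mul_sum, hb1]; ring
  rw [h4]
  refine Finset.sum_le_sum fun x _ => ?_
  rw [Matrix.trace_smul, (hS x).2, smul_eq_mul, mul_one, Complex.ofReal_re]
  rcases eq_or_ne (a x t) 0 with h | h
  · simp [h]; positivity
  · refine le_of_eq ?_
    field_simp
    ring

theorem classicalFidelity_nonneg (p q : ι → ℝ) : 0 ≤ classicalFidelity p q :=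
  Finset.sum_nonneg fun _ _ => by positivity

theorem classicalFidelity_le_one {p q : ι → ℝ} (hp : p ∈ stdSimplex ℝ ι)
    (hq : q ∈ stdSimplex ℝ ι) : classicalFidelity p q ≤ 1 := by
  have h : ∀ x, √(p x) * √(q x) ≤ (p x + q x) / 2 := fun x => by
    nlinarith [sq_nonneg (√(p x) - √(q x)), Real.sq_sqrt (hp.1 x), Real.sq_sqrt (hq.1 x)]
  refine (Finset.sum_le_sum fun x _ => h x).trans (le_of_eq ?_)
  rw [← Finset.sum_div, Finset.sum_add_distrib, hp.2, hq.2]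
  norm_num

theorem eq_of_classicalFidelity_eq_one {p q : ι → ℝ} (hp : p ∈ stdSimplex ℝ ι)
    (hq : q ∈ stdSimplex ℝ ι) (h : classicalFidelity p q = 1) : p = q := by
  have h0 : ∑ x, (√(p x) - √(q x)) ^ 2 = 0 := by
    have : ∀ x, (√(p x) - √(q x)) ^ 2 = p x + q x - 2 * (√(p x) * √(q x)) := fun x => by
      rw [sub_sq, Real.sq_sqrt (hp.1 x), Real.sq_sqrt (hq.1 x)]; ring
    simp only [this, Finset.sum_sub_distrib, Finset.sum_add_distrib, ← Finset.mul_sum]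
    rw [hp.2, hq.2]
    rw [classicalFidelity] at h
    rw [h]
    norm_num
  funext x
  have h1 := (Finset.sum_eq_zero_iff_of_nonneg fun x _ => sq_nonneg _).1 h0 x (Finset.mem_univ x)
  have h2 : √(p x) = √(q x) := by
    have := pow_eq_zero_iff (two_ne_zero) |>.1 h1
    linarith
  rw [← Real.sq_sqrt (hp.1 x), ← Real.sq_sqrt (hq.1 x), h2]

theorem rldDist_mixture_le {S : ι → Matrix n n ℂ} (hS : ∀ x, IsState (S x)) {p q : ι → ℝ}
    (hp : p ∈ stdSimplex ℝ ι) (hq : q ∈ stdSimplex ℝ ι) :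
    rldDist (∑ x, (p x : ℂ) • S x) (∑ x, (q x : ℂ) • S x) ≤
      ENNReal.ofReal (Real.arccos (classicalFidelity p q)) := by
  set c := classicalFidelity p q with hc
  have hc0 : 0 ≤ c := classicalFidelity_nonneg p q
  have hc1 : c ≤ 1 := classicalFidelity_le_one hp hq
  rcases hc1.eq_or_lt with h | h
  -- If the angle is 0 the great circle has no direction, but then `p = q`.
  · rw [← eq_of_classicalFidelity_eq_one hp hq h, rldDist_self (isState_sum hS hp.1 hp.2)]
    exact bot_le
  set θ := Real.arccos c with hθ
  have hcos : Real.cos θ = c := Real.cos_arccos (by linarith) hc1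
  have hsin2 : Real.sin θ ^ 2 = 1 - c ^ 2 := by rw [Real.sin_sq, hcos]
  have hsin : Real.sin θ ≠ 0 := fun h0 => by
    rw [h0] at hsin2; nlinarith
  set u : ι → ℝ := fun x => √(p x) with hu
  -- Gram–Schmidt: the unit vector orthogonal to `√p` in the plane of `√p` and `√q`.
  set w : ι → ℝ := fun x => (√(q x) - c * √(p x)) / Real.sin θ with hw
  have hu2 : ∀ x, u x ^ 2 = p x := fun x => Real.sq_sqrt (hp.1 x)
  have hv2 : ∀ x, (Real.cos θ * u x + Real.sin θ * w x) ^ 2 = q x := fun x => by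
    have : Real.cos θ * u x + Real.sin θ * w x = √(q x) := by
      simp only [hu, hw]
      rw [mul_div_cancel₀ _ hsin, hcos]; ring
    rw [this, Real.sq_sqrt (hq.1 x)]
  have hcs : ∑ x, √(p x) * √(q x) = c := rfl
  have h := rldDist_greatCircle_le hS (u := u) (w := w) (by simp only [hu2, hp.2]) (by
      have : ∀ x, w x ^ 2 = (q x - 2 * c * (√(p x) * √(q x)) + c ^ 2 * p x) / Real.sin θ ^ 2 :=
        fun x => by
          simp only [hw, div_pow]
          congr 1
          rw [sub_sq, mul_pow, Real.sq_sqrt (hp.1 x), Real.sq_sqrt (hq.1 x)]; ring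
      simp only [this, ← Finset.sum_div, Finset.sum_add_distrib, Finset.sum_sub_distrib,
        ← Finset.mul_sum, hcs]
      rw [hp.2, hq.2, div_eq_one_iff_eq (pow_ne_zero 2 hsin), hsin2]
      ring) (by
      have : ∀ x, u x * w x = (√(p x) * √(q x) - c * p x) / Real.sin θ := fun x => by
        simp only [hu, hw]
        rw [mul_div_assoc']
        congr 1
        linear_combination -c * Real.sq_sqrt (hp.1 x)
      simp only [this, ← Finset.sum_div, Finset.sum_sub_distrib, ← Finset.mul_sum, hcs]
      rw [hp.2]; simp) (Real.arccos_nonneg c)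
  simp only [← hθ, hu2, hv2] at h
  exact h

theorem rldDist_le_pi_div_two {ρ σ : Matrix n n ℂ} (hρ : IsState ρ) (hσ : IsState σ) :
    rldDist ρ σ ≤ ENNReal.ofReal (Real.pi / 2) := by
  have h := rldDist_mixture_le (S := ![ρ, σ]) (p := ![1, 0]) (q := ![0, 1])
    (by intro x; fin_cases x <;> simpa)
    ⟨by intro x; fin_cases x <;> simp, by simp⟩ ⟨by intro x; fin_cases x <;> simp, by simp⟩
  simpa [classicalFidelity] using h

end UpperBound

/-! ### Reparametrization and concatenation of paths. -/

section Triangle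

variable {n : Type*} [Fintype n]

theorem hasDerivAt_comp_reparam {m : Type*} {η : ℝ → Matrix m m ℂ}
    (hη : ∀ i j, ContDiffOn ℝ ∞ (fun t => η t i j) (Set.Icc 0 1)) {ψ : ℝ → ℝ} {c t : ℝ}
    (hψ : HasDerivAt ψ c t) (hmem : ∀ s, ψ s ∈ Set.Icc (0 : ℝ) 1) (i j : m) :
    HasDerivAt (fun s => η (ψ s) i j) (((c : ℂ) • velocity η (ψ t)) i j) t := by
  have h1 : HasDerivWithinAt (fun s => η s i j) (velocity η (ψ t) i j) (Set.Icc 0 1) (ψ t) :=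
    (((hη i j).differentiableOn (by simp)) _ (hmem t)).hasDerivWithinAt
  have h2 := HasDerivWithinAt.scomp t h1 hψ.hasDerivWithinAt
    (fun s (_ : s ∈ Set.univ) => hmem s)
  rw [hasDerivWithinAt_univ] at h2
  exact HasDerivAt.congr_deriv (f := fun s => η (ψ s) i j) h2 (by simp)

/-- Change of variables along `ψ`, the speed scaling by `deriv ψ`. Plateaus of `ψ` contribute
nothing, and no measurability of the information in `t` is needed. -/
theorem setLIntegral_rldFisher_le_of_reparam {γ η : ℝ → Matrix n n ℂ}
    (hη : ∀ i j, ContDiffOn ℝ ∞ (fun t => η t i j) (Set.Icc 0 1)) {ψ : ℝ → ℝ}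
    (hψ : Differentiable ℝ ψ) (hmono : Monotone ψ) (hmem : ∀ s, ψ s ∈ Set.Icc (0 : ℝ) 1)
    {s : Set ℝ} (hs : MeasurableSet s) (hs1 : s ⊆ Set.Icc 0 1)
    (heq : ∀ t ∈ s, γ =ᶠ[nhds t] fun r => η (ψ r)) :
    ∫⁻ t in s, rldFisher (γ t) (velocity γ t) ^ (1 / 2 : ℝ) ≤
      ∫⁻ t in Set.Icc (0 : ℝ) 1, rldFisher (η t) (velocity η t) ^ (1 / 2 : ℝ) := by
  have h1 : ∀ t ∈ s, rldFisher (γ t) (velocity γ t) ^ (1 / 2 : ℝ) ≤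
      ENNReal.ofReal (deriv ψ t) *
        rldFisher (η (ψ t)) (velocity η (ψ t)) ^ (1 / 2 : ℝ) := by
    intro t ht
    have hv : velocity γ t = ((deriv ψ t : ℝ) : ℂ) • velocity η (ψ t) := by
      refine velocity_eq_of_hasDerivWithinAt (hs1 ht) fun i j => HasDerivAt.hasDerivWithinAt ?_
      refine (hasDerivAt_comp_reparam hη (hψ t).hasDerivAt hmem i j).congr_of_eventuallyEq ?_
      filter_upwards [heq t ht] with r hr
      rw [hr]
    rw [hv, (heq t ht).eq_of_nhds]
    refine (ENNReal.rpow_le_rpow (rldFisher_smul_le _ _ _) (by norm_num)).trans (le_of_eq ?_)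
    have hd : 0 ≤ deriv ψ t := hmono.deriv_nonneg
    rw [ENNReal.mul_rpow_of_nonneg _ _ (by norm_num),
      ENNReal.ofReal_rpow_of_nonneg (sq_nonneg _) (by norm_num), ← Real.sqrt_eq_rpow,
      Real.sqrt_sq hd]
  calc _ ≤ ∫⁻ t in s, ENNReal.ofReal (deriv ψ t) *
        rldFisher (η (ψ t)) (velocity η (ψ t)) ^ (1 / 2 : ℝ) :=
        MeasureTheory.setLIntegral_mono' hs h1
    _ = ∫⁻ t in ψ '' s, rldFisher (η t) (velocity η t) ^ (1 / 2 : ℝ) :=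
        (MeasureTheory.lintegral_image_eq_lintegral_deriv_mul_of_monotoneOn hs
          (fun t _ => (hψ t).hasDerivAt.hasDerivWithinAt) (hmono.monotoneOn s)
          (fun t => rldFisher (η t) (velocity η t) ^ (1 / 2 : ℝ))).symm
    _ ≤ _ := by
        refine MeasureTheory.lintegral_mono_set ?_
        rintro _ ⟨t, _, rfl⟩
        exact hmem t

/-- Concatenation of two paths, reparametrized so as to be stationary near the junction. -/
theorem exists_isSmoothPath_rldLength_le {ρ σ τ : Matrix n n ℂ} {η ζ : ℝ → Matrix n n ℂ}
    (hη : IsSmoothPath η ρ τ) (hζ : IsSmoothPath ζ τ σ) :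
    ∃ γ, IsSmoothPath γ ρ σ ∧ rldLength γ ≤ rldLength η + rldLength ζ := by
  -- `φ` moves only on `[0, 1/3]` and `ψ` only on `[2/3, 1]`. In between both formulas give `τ`, so
  -- they agree on an open overlap and the glued path is smooth.
  set φ : ℝ → ℝ := fun t => Real.smoothTransition (3 * t) with hφ
  set ψ : ℝ → ℝ := fun t => Real.smoothTransition (3 * t - 2) with hψ
  have hφs : ContDiff ℝ ∞ φ := Real.smoothTransition.contDiff.comp (by fun_prop)
  have hψs : ContDiff ℝ ∞ ψ := Real.smoothTransition.contDiff.comp (by fun_prop)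
  have hφm : Monotone φ := Real.smoothTransition.monotone.comp fun a b h => by
    linarith
  have hψm : Monotone ψ := Real.smoothTransition.monotone.comp fun a b h => by
    linarith
  have hφ01 : ∀ s, φ s ∈ Set.Icc (0 : ℝ) 1 := fun s =>
    ⟨Real.smoothTransition.nonneg _, Real.smoothTransition.le_one _⟩
  have hψ01 : ∀ s, ψ s ∈ Set.Icc (0 : ℝ) 1 := fun s =>
    ⟨Real.smoothTransition.nonneg _, Real.smoothTransition.le_one _⟩
  set γ : ℝ → Matrix n n ℂ := fun t => if t ≤ 1 / 2 then η (φ t) else ζ (ψ t) with hγ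
  have hleft : ∀ t < 2 / 3, γ t = η (φ t) := by
    intro t ht
    by_cases h : t ≤ 1 / 2
    · simp only [hγ, if_pos h]
    · have h1 : φ t = 1 := Real.smoothTransition.one_of_one_le (by linarith)
      have h2 : ψ t = 0 := Real.smoothTransition.zero_of_nonpos (by linarith)
      simp only [hγ, if_neg h, h1, h2, hη.target, hζ.source]
  have hright : ∀ t > 1 / 3, γ t = ζ (ψ t) := by
    intro t ht
    by_cases h : t ≤ 1 / 2
    · have h1 : φ t = 1 := Real.smoothTransition.one_of_one_le (by linarith)
      have h2 : ψ t = 0 := Real.smoothTransition.zero_of_nonpos (by linarith)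
      simp only [hγ, if_pos h, h1, h2, hη.target, hζ.source]
    · simp only [hγ, if_neg h]
  have hleft' : ∀ t < 2 / 3, γ =ᶠ[nhds t] fun r => η (φ r) := fun t ht => by
    filter_upwards [Iio_mem_nhds ht] with r hr using hleft r hr
  have hright' : ∀ t > 1 / 3, γ =ᶠ[nhds t] fun r => ζ (ψ r) := fun t ht => by
    filter_upwards [Ioi_mem_nhds ht] with r hr using hright r hr
  have hcomp : ∀ {ξ : ℝ → Matrix n n ℂ} {χ : ℝ → ℝ},
      (∀ i j, ContDiffOn ℝ ∞ (fun t => ξ t i j) (Set.Icc 0 1)) → ContDiff ℝ ∞ χ →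
      (∀ s, χ s ∈ Set.Icc (0 : ℝ) 1) → ∀ i j, ContDiff ℝ ∞ fun t => ξ (χ t) i j := by
    intro ξ χ h1 h2 h3 i j
    exact (h1 i j).comp_contDiff h2 h3
  refine ⟨γ, ⟨fun i j => ?_, fun t _ => ?_, ?_, ?_⟩, ?_⟩
  · refine ContDiff.contDiffOn (contDiff_iff_contDiffAt.2 fun t => ?_)
    by_cases h : t ≤ 1 / 2
    · refine (hcomp hη.smooth hφs hφ01 i j).contDiffAt.congr_of_eventuallyEq ?_
      filter_upwards [hleft' t (by linarith)] with r hr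
      rw [hr]
    · refine (hcomp hζ.smooth hψs hψ01 i j).contDiffAt.congr_of_eventuallyEq ?_
      filter_upwards [hright' t (by push Not at h; linarith)] with r hr
      rw [hr]
  · simp only [hγ]
    split_ifs
    · exact hη.state _ (hφ01 t)
    · exact hζ.state _ (hψ01 t)
  · rw [hleft 0 (by norm_num)]
    simp [hφ, hη.source]
  · rw [hright 1 (by norm_num)]
    have : ψ 1 = 1 := Real.smoothTransition.one_of_one_le (by norm_num)
    rw [this, hζ.target]
  · unfold rldLength
    rw [← mul_add]
    refine mul_le_mul_right ?_ _
    have hsub : Set.Icc (0 : ℝ) 1 = Set.Icc 0 (1 / 2) ∪ Set.Icc (1 / 2) 1 :=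
      (Set.Icc_union_Icc_eq_Icc (by norm_num) (by norm_num)).symm
    calc _ ≤ (∫⁻ t in Set.Icc (0 : ℝ) (1 / 2), rldFisher (γ t) (velocity γ t) ^ (1 / 2 : ℝ))
          + ∫⁻ t in Set.Icc (1 / 2 : ℝ) 1, rldFisher (γ t) (velocity γ t) ^ (1 / 2 : ℝ) := by
          rw [hsub]
          exact MeasureTheory.lintegral_union_le _ _ _
      _ ≤ _ := add_le_add
        (setLIntegral_rldFisher_le_of_reparam hη.smooth (hφs.differentiable (by simp)) hφm hφ01
          measurableSet_Icc (Set.Icc_subset_Icc le_rfl (by norm_num))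
          fun t ht => hleft' t (lt_of_le_of_lt ht.2 (by norm_num)))
        (setLIntegral_rldFisher_le_of_reparam hζ.smooth (hψs.differentiable (by simp)) hψm hψ01
          measurableSet_Icc (Set.Icc_subset_Icc (by norm_num) le_rfl)
          fun t ht => hright' t (lt_of_lt_of_le (by norm_num) ht.1))

theorem rldDist_triangle (ρ τ σ : Matrix n n ℂ) :
    rldDist ρ σ ≤ rldDist ρ τ + rldDist τ σ := by
  rw [rldDist.eq_1 ρ τ, rldDist.eq_1 τ σ]
  simp only [ENNReal.iInf_add, ENNReal.add_iInf]
  refine le_iInf fun ζ => le_iInf fun hζ => le_iInf fun η => le_iInf fun hη => ?_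
  obtain ⟨γ, hγ, hle⟩ := exists_isSmoothPath_rldLength_le hη hζ
  exact iInf₂_le_of_le γ hγ hle

end Triangle

/-! ### Uhlmann fidelity: continuity, optimal transport and Alberti's inequality. -/

section Fidelity

variable {n : Type*} [Fintype n] [DecidableEq n]

open scoped Matrix.Norms.L2Operator in
theorem continuousOn_cfc_sqrt {X : Type*} [TopologicalSpace X] {a : X → Matrix n n ℂ} {s : Set X}
    (ha : ContinuousOn a s) (h : ∀ x ∈ s, (a x).PosSemidef) :
    ContinuousOn (fun x => CFC.sqrt (a x)) s := by
  simp only [CFC.sqrt_eq_cfc]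
  exact ContinuousOn.cfc_nnreal_of_mem_nhdsSet (s := Set.univ) NNReal.sqrt Filter.univ_mem
    ha (fun x hx => (h x hx).nonneg) NNReal.continuous_sqrt.continuousOn

theorem posSemidef_cfc_sqrt (A : Matrix n n ℂ) : (CFC.sqrt A).PosSemidef :=
  Matrix.nonneg_iff_posSemidef.1 (CFC.sqrt_nonneg A)

theorem posSemidef_sqrt_mul_mul_sqrt {ρ : Matrix n n ℂ} (hρ : ρ.PosSemidef) (σ : Matrix n n ℂ) :
    (CFC.sqrt σ * ρ * CFC.sqrt σ).PosSemidef := by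
  have h := hρ.mul_mul_conjTranspose_same (CFC.sqrt σ)
  rwa [(posSemidef_cfc_sqrt σ).isHermitian.eq] at h

theorem fidelity_nonneg (ρ σ : Matrix n n ℂ) : 0 ≤ fidelity ρ σ :=
  (Complex.nonneg_iff.1 (posSemidef_cfc_sqrt _).trace_nonneg).1

theorem continuousOn_fidelity {X : Type*} [TopologicalSpace X] {a b : X → Matrix n n ℂ} {s : Set X}
    (ha : ContinuousOn a s) (hb : ContinuousOn b s) (ha0 : ∀ x ∈ s, (a x).PosSemidef)
    (hb0 : ∀ x ∈ s, (b x).PosSemidef) : ContinuousOn (fun x => fidelity (a x) (b x)) s := by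
  have h1 := continuousOn_cfc_sqrt hb hb0
  have h2 := continuousOn_cfc_sqrt ((h1.mul ha).mul h1)
    fun x hx => posSemidef_sqrt_mul_mul_sqrt (ha0 x hx) _
  exact Complex.continuous_re.comp_continuousOn
    ((continuous_id.matrix_trace).comp_continuousOn h2)

theorem fidelity_self {ρ : Matrix n n ℂ} (hρ : IsState ρ) : fidelity ρ ρ = 1 := by
  have h0 : (0 : Matrix n n ℂ) ≤ ρ := hρ.1.nonneg
  have h : CFC.sqrt ρ * ρ * CFC.sqrt ρ = ρ * ρ := by
    have hQ := CFC.sqrt_mul_sqrt_self ρ h0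
    calc CFC.sqrt ρ * ρ * CFC.sqrt ρ = CFC.sqrt ρ * (CFC.sqrt ρ * CFC.sqrt ρ) * CFC.sqrt ρ := by
          rw [hQ]
      _ = CFC.sqrt ρ * CFC.sqrt ρ * (CFC.sqrt ρ * CFC.sqrt ρ) := by simp only [Matrix.mul_assoc]
      _ = ρ * ρ := by rw [hQ]
  rw [fidelity, h, CFC.sqrt_mul_self ρ h0, hρ.trace_re]

theorem re_trace_mul_nonneg {A B : Matrix n n ℂ} (hA : A.PosSemidef) (hB : B.PosSemidef) :
    0 ≤ (A * B).trace.re := by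
  have h := re_trace_mul_mul_conjTranspose_nonneg hB (CFC.sqrt A)
  rwa [(posSemidef_cfc_sqrt A).isHermitian.eq, Matrix.trace_mul_comm, ← Matrix.mul_assoc,
    CFC.sqrt_mul_sqrt_self A hA.nonneg] at h

/-- The optimal transport operator between two positive definite matrices. -/
theorem exists_posDef_mul_mul_eq {ρ γ : Matrix n n ℂ} (hρ : ρ.PosDef) (hγ : γ.PosDef) :
    ∃ M : Matrix n n ℂ, M.PosDef ∧ M * γ * M = ρ ∧ (γ * M).trace.re = fidelity ρ γ := by
  have hγ0 : (0 : Matrix n n ℂ) ≤ γ := hγ.posSemidef.nonneg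
  set Q := CFC.sqrt γ with hQ
  have hQQ : Q * Q = γ := CFC.sqrt_mul_sqrt_self γ hγ0
  have hQh : Q.conjTranspose = Q := (posSemidef_cfc_sqrt γ).isHermitian.eq
  have hQu : IsUnit Q := (CFC.isUnit_sqrt_iff γ hγ0).2 hγ.isUnit
  have hQd : IsUnit Q.det := (Matrix.isUnit_iff_isUnit_det Q).1 hQu
  have hQρQ : (Q * ρ * Q).PosDef := by
    refine ((posSemidef_sqrt_mul_mul_sqrt hρ.posSemidef γ).posDef_iff_isUnit).2 ?_
    exact (hQu.mul hρ.isUnit).mul hQu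
  set S := CFC.sqrt (Q * ρ * Q) with hS
  have hSS : S * S = Q * ρ * Q := CFC.sqrt_mul_sqrt_self _ hQρQ.posSemidef.nonneg
  have hSp : S.PosDef := ((posSemidef_cfc_sqrt _).posDef_iff_isUnit).2
    ((CFC.isUnit_sqrt_iff _ hQρQ.posSemidef.nonneg).2 hQρQ.isUnit)
  have hQ1 : Q * Q⁻¹ = 1 := Matrix.mul_nonsing_inv Q hQd
  have hQ2 : Q⁻¹ * Q = 1 := Matrix.nonsing_inv_mul Q hQd
  have hQiu : IsUnit Q⁻¹ := ⟨⟨Q⁻¹, Q, hQ2, hQ1⟩, rfl⟩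
  have hQih : (Q⁻¹).conjTranspose = Q⁻¹ := by rw [Matrix.conjTranspose_nonsing_inv, hQh]
  refine ⟨Q⁻¹ * S * Q⁻¹, ?_, ?_, ?_⟩
  · have h := hSp.posSemidef.mul_mul_conjTranspose_same Q⁻¹
    rw [hQih] at h
    exact h.posDef_iff_isUnit.2 ((hQiu.mul hSp.isUnit).mul hQiu)
  · calc Q⁻¹ * S * Q⁻¹ * γ * (Q⁻¹ * S * Q⁻¹)
        = Q⁻¹ * S * (Q⁻¹ * Q) * (Q * Q⁻¹) * S * Q⁻¹ := by rw [← hQQ]; simp only [Matrix.mul_assoc]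
      _ = Q⁻¹ * (S * S) * Q⁻¹ := by
          rw [hQ1, hQ2]; simp only [Matrix.mul_assoc, Matrix.mul_one]
      _ = (Q⁻¹ * Q) * ρ * (Q * Q⁻¹) := by rw [hSS]; simp only [Matrix.mul_assoc]
      _ = ρ := by rw [hQ1, hQ2, Matrix.one_mul, Matrix.mul_one]
  · have h : γ * (Q⁻¹ * S * Q⁻¹) = Q * (S * Q⁻¹) := by
      calc γ * (Q⁻¹ * S * Q⁻¹) = Q * (Q * Q⁻¹) * (S * Q⁻¹) := by
            rw [← hQQ]; simp only [Matrix.mul_assoc]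
        _ = _ := by rw [hQ1, Matrix.mul_one]
    rw [h, Matrix.trace_mul_comm, Matrix.mul_assoc, hQ2, Matrix.mul_one, fidelity]

/-- Alberti's inequality, in the form of a supporting hyperplane: `M` and `N` transport `γ'`,
resp. `γ`, to `ρ`. -/
theorem two_mul_re_trace_mul_le {ρ γ γ' M N : Matrix n n ℂ} (hγ : γ.PosSemidef)
    (hM : M.PosDef) (hN : N.IsHermitian) (hMρ : M * γ' * M = ρ) (hNρ : N * γ * N = ρ) :
    2 * (γ * N).trace.re ≤ (γ * M).trace.re + (γ' * M).trace.re := by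
  have hMd : IsUnit M.det := (Matrix.isUnit_iff_isUnit_det M).1 hM.isUnit
  have hM1 : M * M⁻¹ = 1 := Matrix.mul_nonsing_inv M hMd
  have hM2 : M⁻¹ * M = 1 := Matrix.nonsing_inv_mul M hMd
  have hpos := hM.inv.posSemidef.mul_mul_conjTranspose_same (M - N)
  rw [Matrix.conjTranspose_sub, hM.isHermitian.eq, hN.eq] at hpos
  -- This positive semidefinite matrix is paired with `γ`. The last term contributes `tr (γ' M)`
  -- because `N γ N = ρ = M γ' M`.
  have hexp : (M - N) * M⁻¹ * (M - N) = M - N - N + N * M⁻¹ * N := by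
    simp only [Matrix.sub_mul, Matrix.mul_sub, hM1, Matrix.one_mul, Matrix.mul_assoc, hM2,
      Matrix.mul_one]
    abel
  have h := re_trace_mul_nonneg hγ hpos
  have h2 : (γ * (N * M⁻¹ * N)).trace = (γ' * M).trace := by
    calc (γ * (N * M⁻¹ * N)).trace = (γ * N * M⁻¹ * N).trace := by simp only [Matrix.mul_assoc]
      _ = (N * (γ * N * M⁻¹)).trace := Matrix.trace_mul_comm _ _
      _ = (M * γ' * M * M⁻¹).trace := by rw [hMρ, ← hNρ]; simp only [Matrix.mul_assoc]
      _ = (γ' * M).trace := by rw [Matrix.mul_assoc, hM1, Matrix.mul_one, Matrix.trace_mul_comm]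
  rw [hexp, Matrix.mul_add, Matrix.mul_sub, Matrix.mul_sub, Matrix.trace_add, Matrix.trace_sub,
    Matrix.trace_sub, h2] at h
  simp only [Complex.add_re, Complex.sub_re] at h
  linarith

/-- The inverse of the transport from `γ` to `ρ` and the transport from `ρ` to `γ` solve the same
equation; Alberti's inequality in both directions equates their traces against `ρ`. -/
theorem fidelity_comm_of_posDef {ρ γ : Matrix n n ℂ} (hρ : ρ.PosDef) (hγ : γ.PosDef) :
    fidelity ρ γ = fidelity γ ρ := by
  obtain ⟨M, hM, hMρ, hMf⟩ := exists_posDef_mul_mul_eq hρ hγ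
  obtain ⟨N, hN, hNγ, hNf⟩ := exists_posDef_mul_mul_eq hγ hρ
  have hMd : IsUnit M.det := (Matrix.isUnit_iff_isUnit_det M).1 hM.isUnit
  have hM1 : M * M⁻¹ = 1 := Matrix.mul_nonsing_inv M hMd
  have hM2 : M⁻¹ * M = 1 := Matrix.nonsing_inv_mul M hMd
  have hMγ : M⁻¹ * ρ * M⁻¹ = γ := by
    calc M⁻¹ * ρ * M⁻¹ = (M⁻¹ * M) * γ * (M * M⁻¹) := by
          rw [← hMρ]; simp only [Matrix.mul_assoc]
      _ = γ := by rw [hM1, hM2, Matrix.one_mul, Matrix.mul_one]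
  have htr : (ρ * M⁻¹).trace.re = (γ * M).trace.re := by
    rw [← hMρ, Matrix.mul_assoc, hM1, Matrix.mul_one, Matrix.trace_mul_comm]
  have h1 := two_mul_re_trace_mul_le hρ.posSemidef hN hM.inv.isHermitian hNγ hMγ
  have h2 := two_mul_re_trace_mul_le hρ.posSemidef hM.inv hN.isHermitian hMγ hNγ
  linarith

/-- The growth rate of the fidelity is controlled by the RLD Fisher information. -/
theorem re_trace_mul_mul_le_sqrt_mul_sqrt {ρ γ M L : Matrix n n ℂ} (hρ : IsState ρ) (hγ : IsState γ)
    (hM : M.IsHermitian) (hMρ : M * γ * M = ρ) (hL : (L * γ).trace = 0) :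
    (L * γ * M).trace.re ≤
      √(L.conjTranspose * L * γ).trace.re * √(1 - (γ * M).trace.re ^ 2) := by
  set f := (γ * M).trace.re with hf
  -- Centering `M` at its mean `f` leaves the left side unchanged, as `tr (L γ) = 0`, and lowers the
  -- second factor from 1 to the variance `1 - f ^ 2`.
  have h := re_trace_mul_mul_sq_le hγ.1 L (M - (f : ℂ) • 1)
  have hXh : (M - (f : ℂ) • (1 : Matrix n n ℂ)).conjTranspose = M - (f : ℂ) • 1 := by
    simp [Matrix.conjTranspose_sub, Matrix.conjTranspose_smul, hM.eq]
  have hMγ : (M * γ).trace.re = f := by rw [Matrix.trace_mul_comm]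
  have h1 : (L * γ * (M - (f : ℂ) • 1)).trace.re = (L * γ * M).trace.re := by
    simp [Matrix.mul_sub, hL]
  have h2 : ((M - (f : ℂ) • 1) * γ * (M - (f : ℂ) • 1)).trace.re = 1 - f ^ 2 := by
    simp only [Matrix.mul_sub, Matrix.sub_mul, hMρ, Matrix.mul_smul, Matrix.smul_mul,
      Matrix.mul_one, Matrix.one_mul, Matrix.trace_sub, Matrix.trace_smul, Complex.sub_re,
      smul_eq_mul, Complex.re_ofReal_mul, hρ.trace_re, hγ.trace_re, hMγ, ← hf]
    ring
  rw [hXh, h1, h2, ← re_trace_conjTranspose_mul_mul] at h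
  have h0 : 0 ≤ (L.conjTranspose * L * γ).trace.re := by
    rw [re_trace_conjTranspose_mul_mul]; exact re_trace_mul_mul_conjTranspose_nonneg hγ.1 L
  rw [← Real.sqrt_mul h0]
  exact Real.le_sqrt_of_sq_le h

end Fidelity

/-! ### A comparison principle for functions growing at most like a cosine. -/

section Fence

/-- A function on `[0, 1]` which grows no faster than a cosine with angular speed `k` needs an
angle `∫ k` to reach the value `1`. -/
theorem arccos_le_integral_of_slope_le {g g' k : ℝ → ℝ} (hg : ContinuousOn g (Set.Icc 0 1))
    (hslope : ∀ x ∈ Set.Ico (0 : ℝ) 1, ∀ r, g' x < r →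
      ∃ᶠ z in nhdsWithin x (Set.Ioi x), slope g x z < r)
    (hk : Continuous k) (hk0 : ∀ x, 0 ≤ k x)
    (hbound : ∀ x ∈ Set.Ico (0 : ℝ) 1, g' x ≤ k x * √(1 - g x ^ 2))
    (hg0 : 0 ≤ g 0) (hg1 : g 1 = 1) : Real.arccos (g 0) ≤ ∫ x in (0 : ℝ)..1, k x := by
  by_contra! hlt
  set θ := Real.arccos (g 0) with hθ
  set K := ∫ x in (0 : ℝ)..1, k x with hK
  have hK0 : 0 ≤ K := intervalIntegral.integral_nonneg zero_le_one fun x _ => hk0 x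
  have hg01 : g 0 < 1 := Real.arccos_pos.1 (hK0.trans_lt hlt)
  have hθ2 : θ ≤ Real.pi / 2 := Real.arccos_le_pi_div_two.2 hg0
  -- Half of the gap: it makes the barrier `cos (θ - Ψ)` strictly steeper than `g` at a contact, and
  -- still `θ - Ψ 1 = δ > 0`, so the barrier stays below 1.
  set δ := (θ - K) / 2 with hδ
  have hδ0 : 0 < δ := by simp only [hδ]; linarith
  set Ψ : ℝ → ℝ := fun u => (∫ x in (0 : ℝ)..u, k x) + δ * u with hΨ
  have hΨd : ∀ u, HasDerivAt Ψ (k u + δ) u := fun u => by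
    have h1 := (hk.integral_hasStrictDerivAt 0 u).hasDerivAt
    have h2 : HasDerivAt (fun u => δ * u) δ u := by simpa using (hasDerivAt_id u).const_mul δ
    exact h1.add h2
  have hΨm : Monotone Ψ := monotone_of_deriv_nonneg (fun u => (hΨd u).differentiableAt)
    fun u => by rw [(hΨd u).deriv]; linarith [hk0 u]
  have hΨ0 : Ψ 0 = 0 := by simp [hΨ]
  have hΨ1 : Ψ 1 = K + δ := by simp [hΨ, hK]
  have hBd : ∀ u, HasDerivAt (fun u => Real.cos (θ - Ψ u))
      (Real.sin (θ - Ψ u) * (k u + δ)) u := fun u => by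
    refine ((hΨd u).const_sub θ).cos.congr_deriv ?_
    ring
  have hrange : ∀ u ∈ Set.Icc (0 : ℝ) 1, 0 < θ - Ψ u ∧ θ - Ψ u < Real.pi := by
    intro u hu
    have h1 := hΨm hu.1
    have h2 := hΨm hu.2
    rw [hΨ0] at h1
    rw [hΨ1] at h2
    constructor
    · simp only [hδ] at h2 ⊢; linarith
    · linarith [Real.pi_pos]
  have hle := image_le_of_liminf_slope_right_lt_deriv_boundary hg hslope
    (B := fun u => Real.cos (θ - Ψ u)) (by
      simp only [hΨ0, sub_zero]
      rw [Real.cos_arccos (by linarith) hg01.le]) hBd (by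
      intro x hx hxB
      obtain ⟨h1, h2⟩ := hrange x (Set.Ico_subset_Icc_self hx)
      have hs : 0 < Real.sin (θ - Ψ x) := Real.sin_pos_of_pos_of_lt_pi h1 h2
      refine (hbound x hx).trans_lt ?_
      rw [hxB, ← Real.sin_sq, Real.sqrt_sq hs.le]
      nlinarith) (Set.right_mem_Icc.2 zero_le_one)
  obtain ⟨h1, h2⟩ := hrange 1 (Set.right_mem_Icc.2 zero_le_one)
  have hcos : Real.cos (θ - Ψ 1) < Real.cos 0 :=
    Real.cos_lt_cos_of_nonneg_of_le_pi le_rfl h2.le h1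
  rw [Real.cos_zero] at hcos
  rw [hg1] at hle
  linarith

end Fence

/-! ### RLD length is at least the Bures angle; consequences for `FR`. -/

section LowerBound

variable {n : Type*} [Fintype n]

theorem IsSmoothPath.hasDerivWithinAt {γ : ℝ → Matrix n n ℂ} {ρ σ : Matrix n n ℂ}
    (h : IsSmoothPath γ ρ σ) {t : ℝ} (ht : t ∈ Set.Icc (0 : ℝ) 1) (i j : n) :
    HasDerivWithinAt (fun s => γ s i j) (velocity γ t i j) (Set.Icc 0 1) t :=
  (((h.smooth i j).differentiableOn (by simp)) t ht).hasDerivWithinAt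

theorem IsSmoothPath.continuousOn {γ : ℝ → Matrix n n ℂ} {ρ σ : Matrix n n ℂ}
    (h : IsSmoothPath γ ρ σ) : ContinuousOn γ (Set.Icc 0 1) :=
  continuousOn_pi.2 fun i => continuousOn_pi.2 fun j => (h.smooth i j).continuousOn

theorem IsSmoothPath.continuousOn_velocity {γ : ℝ → Matrix n n ℂ} {ρ σ : Matrix n n ℂ}
    (h : IsSmoothPath γ ρ σ) : ContinuousOn (velocity γ) (Set.Icc 0 1) :=
  continuousOn_pi.2 fun i => continuousOn_pi.2 fun j =>
    (h.smooth i j).continuousOn_derivWithin (uniqueDiffOn_Icc zero_lt_one) (by simp)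

theorem IsSmoothPath.trace_velocity {γ : ℝ → Matrix n n ℂ} {ρ σ : Matrix n n ℂ}
    (h : IsSmoothPath γ ρ σ) {t : ℝ} (ht : t ∈ Set.Icc (0 : ℝ) 1) :
    (velocity γ t).trace = 0 := by
  have h1 : HasDerivWithinAt (fun s => ∑ i, γ s i i) (∑ i, velocity γ t i i) (Set.Icc 0 1) t :=
    HasDerivWithinAt.fun_sum fun i _ => h.hasDerivWithinAt ht i i
  have h2 : HasDerivWithinAt (fun s => ∑ i, γ s i i) 0 (Set.Icc 0 1) t :=
    (hasDerivWithinAt_const t (Set.Icc 0 1) (1 : ℂ)).congr (fun s hs => (h.state s hs).2)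
      (h.state t ht).2
  exact (uniqueDiffOn_Icc zero_lt_one t ht).eq_deriv _ h1 h2

theorem IsSmoothPath.hasDerivWithinAt_trace_mul {γ : ℝ → Matrix n n ℂ} {ρ σ : Matrix n n ℂ}
    (h : IsSmoothPath γ ρ σ) {t : ℝ} (ht : t ∈ Set.Icc (0 : ℝ) 1) (M : Matrix n n ℂ) :
    HasDerivWithinAt (fun s => (γ s * M).trace.re) (velocity γ t * M).trace.re
      (Set.Icc 0 1) t := by
  have h1 : HasDerivWithinAt (fun s => (γ s * M).trace) (velocity γ t * M).trace
      (Set.Icc 0 1) t := by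
    simp only [Matrix.trace, Matrix.diag, Matrix.mul_apply]
    exact HasDerivWithinAt.fun_sum fun i _ => HasDerivWithinAt.fun_sum fun j _ =>
      (h.hasDerivWithinAt ht i j).mul_const (M j i)
  exact Complex.reCLM.hasFDerivAt.comp_hasDerivWithinAt t h1

/-- Along a path of positive definite states, the RLD length is at least the Bures angle. -/
theorem arccos_fidelity_le_integral [DecidableEq n] {γ : ℝ → Matrix n n ℂ} {ρ σ : Matrix n n ℂ}
    (h : IsSmoothPath γ ρ σ) (hpos : ∀ t ∈ Set.Icc (0 : ℝ) 1, (γ t).PosDef) {k : ℝ → ℝ}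
    (hk : Continuous k) (hk0 : ∀ x, 0 ≤ k x)
    (hkJ : ∀ t ∈ Set.Icc (0 : ℝ) 1, ∀ L : Matrix n n ℂ, velocity γ t = L * γ t →
      2⁻¹ * √(L.conjTranspose * L * γ t).trace.re ≤ k t) :
    Real.arccos (fidelity σ ρ) ≤ ∫ x in (0 : ℝ)..1, k x := by
  have h1mem : (1 : ℝ) ∈ Set.Icc (0 : ℝ) 1 := Set.right_mem_Icc.2 zero_le_one
  have hσ : IsState σ := h.target ▸ h.state 1 h1mem
  have hσp : σ.PosDef := h.target ▸ hpos 1 h1mem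
  have hex : ∀ t : ℝ, ∃ M : Matrix n n ℂ, t ∈ Set.Icc (0 : ℝ) 1 →
      M.PosDef ∧ M * γ t * M = σ ∧ (γ t * M).trace.re = fidelity σ (γ t) := by
    intro t
    by_cases ht : t ∈ Set.Icc (0 : ℝ) 1
    · obtain ⟨M, hM⟩ := exists_posDef_mul_mul_eq hσp (hpos t ht)
      exact ⟨M, fun _ => hM⟩
    · exact ⟨0, fun h => absurd h ht⟩
  choose M hM using hex
  have hmain := arccos_le_integral_of_slope_le (g := fun t => fidelity σ (γ t))
    (g' := fun t => 2⁻¹ * (velocity γ t * M t).trace.re) (k := k)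
    (continuousOn_fidelity continuousOn_const h.continuousOn (fun _ _ => hσ.1)
      fun t ht => (h.state t ht).1)
    (by
      intro x hx r hr
      have hxI := Set.Ico_subset_Icc_self hx
      obtain ⟨hMx, hMσ, hMf⟩ := hM x hxI
      have hd : HasDerivWithinAt (fun s => 2⁻¹ * (γ s * M x).trace.re)
          (2⁻¹ * (velocity γ x * M x).trace.re) (Set.Icc 0 1) x :=
        (h.hasDerivWithinAt_trace_mul hxI (M x)).const_mul _
      have hd2 : HasDerivWithinAt (fun s => 2⁻¹ * (γ s * M x).trace.re)
          (2⁻¹ * (velocity γ x * M x).trace.re) (Set.Ioi x) x :=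
        hd.mono_of_mem_nhdsWithin (Filter.mem_of_superset (Ioc_mem_nhdsGT hx.2)
          fun z hz => ⟨hx.1.trans hz.1.le, hz.2⟩)
      rw [hasDerivWithinAt_iff_tendsto_slope' (by simp)] at hd2
      refine Filter.Eventually.frequently ?_
      filter_upwards [hd2.eventually_lt_const hr, Ioc_mem_nhdsGT hx.2] with z hz hzI
      have hzI' : z ∈ Set.Icc (0 : ℝ) 1 := ⟨hx.1.trans hzI.1.le, hzI.2⟩
      obtain ⟨hMz, hMzσ, hMzf⟩ := hM z hzI'
      -- The affine majorant built at `x` bounds the fidelity at `z`, so difference quotients are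
      -- controlled without differentiating the fidelity.
      have hA := two_mul_re_trace_mul_le (h.state z hzI').1 hMx hMz.isHermitian hMσ hMzσ
      refine lt_of_le_of_lt ?_ hz
      rw [slope_def_field, slope_def_field]
      refine div_le_div_of_nonneg_right ?_ (sub_nonneg.2 hzI.1.le)
      rw [← hMf, ← hMzf]
      linarith)
    hk hk0
    (by
      intro x hx
      have hxI := Set.Ico_subset_Icc_self hx
      obtain ⟨hMx, hMσ, hMf⟩ := hM x hxI
      have hdet : IsUnit (γ x).det := (Matrix.isUnit_iff_isUnit_det _).1 (hpos x hxI).isUnit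
      set L := velocity γ x * (γ x)⁻¹ with hL
      have hLγ : L * γ x = velocity γ x := by
        rw [hL, Matrix.mul_assoc, Matrix.nonsing_inv_mul _ hdet, Matrix.mul_one]
      have hb := re_trace_mul_mul_le_sqrt_mul_sqrt hσ (h.state x hxI) hMx.isHermitian hMσ
        (L := L) (by rw [hLγ, h.trace_velocity hxI])
      rw [hLγ, hMf] at hb
      have hkx := hkJ x hxI L hLγ.symm
      have hs := Real.sqrt_nonneg (1 - fidelity σ (γ x) ^ 2)
      calc _ ≤ 2⁻¹ * (√(L.conjTranspose * L * γ x).trace.re *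
            √(1 - fidelity σ (γ x) ^ 2)) := by gcongr
        _ = 2⁻¹ * √(L.conjTranspose * L * γ x).trace.re *
            √(1 - fidelity σ (γ x) ^ 2) := by ring
        _ ≤ _ := mul_le_mul_of_nonneg_right hkx hs)
    (fidelity_nonneg _ _) (by rw [h.target, fidelity_self hσ])
  rwa [h.source] at hmain

/-- Mixing `A` with the state `τ`. -/
def depolarize {m : Type*} (τ : Matrix m m ℂ) (ε : ℝ) (A : Matrix m m ℂ) : Matrix m m ℂ :=
  ((1 - ε : ℝ) : ℂ) • A + (ε : ℂ) • τ

theorem depolarize_isState {τ A : Matrix n n ℂ} (hτ : IsState τ) (hA : IsState A) {ε : ℝ}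
    (h0 : 0 ≤ ε) (h1 : ε ≤ 1) : IsState (depolarize τ ε A) := by
  refine ⟨(hA.1.smul (by exact_mod_cast sub_nonneg.2 h1)).add
    (hτ.1.smul (by exact_mod_cast h0)), ?_⟩
  simp [depolarize, hA.2, hτ.2]

theorem depolarize_posDef {m : Type*} {τ A : Matrix m m ℂ} (hτ : τ.PosDef) (hA : A.PosSemidef) {ε : ℝ}
    (h0 : 0 < ε) (h1 : ε ≤ 1) : (depolarize τ ε A).PosDef :=
  Matrix.PosDef.posSemidef_add (hA.smul (by exact_mod_cast sub_nonneg.2 h1))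
    (hτ.smul (by exact_mod_cast h0))

theorem depolarize_isSmoothPath {γ : ℝ → Matrix n n ℂ} {ρ σ τ : Matrix n n ℂ}
    (h : IsSmoothPath γ ρ σ) (hτ : IsState τ) {ε : ℝ} (h0 : 0 ≤ ε) (h1 : ε ≤ 1) :
    IsSmoothPath (fun t => depolarize τ ε (γ t)) (depolarize τ ε ρ) (depolarize τ ε σ) := by
  refine ⟨fun i j => ?_, fun t ht => depolarize_isState hτ (h.state t ht) h0 h1, by rw [h.source],
    by rw [h.target]⟩
  simp only [depolarize, Matrix.add_apply, Matrix.smul_apply, smul_eq_mul]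
  exact (contDiffOn_const.mul (h.smooth i j)).add contDiffOn_const

theorem velocity_depolarize {γ : ℝ → Matrix n n ℂ} {ρ σ τ : Matrix n n ℂ}
    (h : IsSmoothPath γ ρ σ) (ε : ℝ) {t : ℝ} (ht : t ∈ Set.Icc (0 : ℝ) 1) :
    velocity (fun t => depolarize τ ε (γ t)) t = ((1 - ε : ℝ) : ℂ) • velocity γ t := by
  refine velocity_eq_of_hasDerivWithinAt ht fun i j => ?_
  simp only [depolarize, Matrix.add_apply, Matrix.smul_apply, smul_eq_mul]
  exact ((h.hasDerivWithinAt ht i j).const_mul _).add_const _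

/-- Mixing with a fixed `τ` does not increase the information: apply joint convexity with
logarithmic derivative 0 on the component `τ`, which does not move. -/
theorem ofReal_re_trace_le_rldFisher {τ ρ D L : Matrix n n ℂ} (hτ : τ.PosSemidef)
    (hρ : ρ.PosSemidef) {ε : ℝ} (h0 : 0 ≤ ε) (h1 : ε ≤ 1)
    (hL : ((1 - ε : ℝ) : ℂ) • D = L * depolarize τ ε ρ) :
    ENNReal.ofReal (L.conjTranspose * L * depolarize τ ε ρ).trace.re ≤ rldFisher ρ D := by
  refine le_iInf₂ fun K hK => ENNReal.ofReal_le_ofReal ?_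
  have hsum : ∑ x, (![((1 - ε : ℝ) : ℂ) • ρ, (ε : ℂ) • τ] : Fin 2 → Matrix n n ℂ) x
      = depolarize τ ε ρ := by simp [depolarize]
  have hmix := re_trace_le_sum_of_mul_sum_eq
    (R := ![((1 - ε : ℝ) : ℂ) • ρ, (ε : ℂ) • τ]) (K := ![K, 0]) (L := L) (by
      intro x
      fin_cases x
      · exact hρ.smul (by exact_mod_cast sub_nonneg.2 h1)
      · exact hτ.smul (by exact_mod_cast h0)) (by
      rw [hsum, ← hL, hK]
      simp [Matrix.mul_smul])
  rw [hsum] at hmix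
  refine hmix.trans ?_
  have hJ : 0 ≤ (K.conjTranspose * K * ρ).trace.re := by
    rw [re_trace_conjTranspose_mul_mul]; exact re_trace_mul_mul_conjTranspose_nonneg hρ K
  simp only [Fin.sum_univ_two, Matrix.cons_val_zero, Matrix.cons_val_one, Matrix.mul_smul,
    Matrix.trace_smul, smul_eq_mul, Complex.re_ofReal_mul, Matrix.conjTranspose_zero,
    Matrix.zero_mul, Matrix.trace_zero, Complex.zero_re]
  nlinarith

theorem ofReal_arccos_fidelity_depolarize_le [DecidableEq n] {γ : ℝ → Matrix n n ℂ}
    {ρ σ τ : Matrix n n ℂ} (h : IsSmoothPath γ ρ σ) (hτ : IsState τ) (hτp : τ.PosDef) {ε : ℝ}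
    (h0 : 0 < ε) (h1 : ε ≤ 1) :
    ENNReal.ofReal (Real.arccos (fidelity (depolarize τ ε ρ) (depolarize τ ε σ))) ≤
      rldLength γ := by
  set η : ℝ → Matrix n n ℂ := fun t => depolarize τ ε (γ t) with hη
  have hpath : IsSmoothPath η (depolarize τ ε ρ) (depolarize τ ε σ) :=
    depolarize_isSmoothPath h hτ h0.le h1
  have hpos : ∀ t ∈ Set.Icc (0 : ℝ) 1, (η t).PosDef := fun t ht =>
    depolarize_posDef hτp (h.state t ht).1 h0 h1
  -- Clamping time to `[0, 1]` makes the speed continuous on all of `ℝ`, as the comparison principle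
  -- requires.
  set c : ℝ → ℝ := fun t => max 0 (min 1 t) with hc
  have hcc : Continuous c := by fun_prop
  have hcI : ∀ t, c t ∈ Set.Icc (0 : ℝ) 1 := fun t => by simp [hc]
  have hcid : ∀ t ∈ Set.Icc (0 : ℝ) 1, c t = t := fun t ht => by simp [hc, ht.1, ht.2]
  set Λ : ℝ → Matrix n n ℂ := fun t => velocity η (c t) * (η (c t))⁻¹ with hΛ
  have hdet : ∀ t ∈ Set.Icc (0 : ℝ) 1, IsUnit (η t).det := fun t ht =>
    (Matrix.isUnit_iff_isUnit_det _).1 (hpos t ht).isUnit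
  have hηc : Continuous fun t => η (c t) := hpath.continuousOn.comp_continuous hcc hcI
  have hvc : Continuous fun t => velocity η (c t) :=
    hpath.continuousOn_velocity.comp_continuous hcc hcI
  have hinv : Continuous fun t => (η (c t))⁻¹ := by
    simp only [Matrix.inv_def, Ring.inverse_eq_inv']
    exact (hηc.matrix_det.inv₀ fun t => (hdet _ (hcI t)).ne_zero).smul hηc.matrix_adjugate
  have hΛc : Continuous Λ := hvc.mul hinv
  set J : ℝ → ℝ := fun t => ((Λ t).conjTranspose * Λ t * η (c t)).trace.re with hJ
  have hJc : Continuous J := Complex.continuous_re.comp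
    ((hΛc.matrix_conjTranspose.mul hΛc).mul hηc).matrix_trace
  set k : ℝ → ℝ := fun t => 2⁻¹ * √(J t) with hk
  have hkc : Continuous k := continuous_const.mul hJc.sqrt
  have hk0 : ∀ t, 0 ≤ k t := fun t => by simp only [hk]; positivity
  have hle := arccos_fidelity_le_integral hpath hpos hkc hk0 (by
    intro t ht L hL
    have hLΛ : L = Λ t := by
      simp only [hΛ, hcid t ht]
      rw [hL, Matrix.mul_assoc, Matrix.mul_nonsing_inv _ (hdet t ht), Matrix.mul_one]
    simp only [hk, hJ, hcid t ht, hLΛ]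
    exact le_rfl)
  rw [fidelity_comm_of_posDef (depolarize_posDef hτp (h.source ▸ (h.state 0 (by simp)).1) h0 h1)
    (depolarize_posDef hτp (h.target ▸ (h.state 1 (by simp)).1) h0 h1)]
  refine (ENNReal.ofReal_le_ofReal hle).trans ?_
  rw [intervalIntegral.integral_of_le zero_le_one, ← MeasureTheory.integral_Icc_eq_integral_Ioc,
    MeasureTheory.ofReal_integral_eq_lintegral_ofReal
      (hkc.continuousOn.integrableOn_compact isCompact_Icc)
      (Filter.Eventually.of_forall hk0), rldLength,
    ← MeasureTheory.lintegral_const_mul' _ _ (by simp)]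
  refine MeasureTheory.setLIntegral_mono' measurableSet_Icc fun t ht => ?_
  simp only [hk]
  rw [ENNReal.ofReal_mul (by norm_num), ENNReal.ofReal_inv_of_pos (by norm_num),
    ENNReal.ofReal_ofNat, Real.sqrt_eq_rpow]
  have hJ0 : 0 ≤ J t := by
    simp only [hJ]
    rw [re_trace_conjTranspose_mul_mul]
    exact re_trace_mul_mul_conjTranspose_nonneg (hpos _ (hcI t)).posSemidef _
  rw [← ENNReal.ofReal_rpow_of_nonneg hJ0 (by norm_num)]
  gcongr
  simp only [hJ]
  rw [hcid t ht]
  refine ofReal_re_trace_le_rldFisher hτ.1 (h.state t ht).1 h0.le h1 ?_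
  rw [← velocity_depolarize (τ := τ) h ε ht]
  simp only [hΛ, hcid t ht]
  rw [Matrix.mul_assoc, Matrix.nonsing_inv_mul _ (hdet t ht), Matrix.mul_one]

theorem exists_isState_posDef [Nonempty n] : ∃ τ : Matrix n n ℂ, IsState τ ∧ τ.PosDef := by
  classical
  have hc : (0 : ℝ) < (Fintype.card n : ℝ)⁻¹ := by positivity
  have hp : ((((Fintype.card n : ℝ)⁻¹ : ℝ) : ℂ) • (1 : Matrix n n ℂ)).PosDef :=
    Matrix.PosDef.one.smul (by exact_mod_cast hc)
  refine ⟨_, ⟨hp.posSemidef, ?_⟩, hp⟩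
  simp

/-- For each path the bound holds at every mixing weight `ε > 0` with the same right side, so only
continuity of the fidelity is needed as `ε → 0`. -/
theorem ofReal_arccos_fidelity_le_rldDist [DecidableEq n] {ρ σ : Matrix n n ℂ} (hρ : IsState ρ)
    (hσ : IsState σ) : ENNReal.ofReal (Real.arccos (fidelity ρ σ)) ≤ rldDist ρ σ := by
  have : Nonempty n := by
    by_contra hn
    rw [not_nonempty_iff] at hn
    simpa using hρ.2
  obtain ⟨τ, hτ, hτp⟩ := exists_isState_posDef (n := n)
  refine le_iInf₂ fun γ hγ => ?_
  have hcont : ∀ A : Matrix n n ℂ, Continuous fun ε : ℝ => depolarize τ ε A := fun A => by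
    unfold depolarize
    fun_prop
  have hF : ContinuousOn (fun ε : ℝ => fidelity (depolarize τ ε ρ) (depolarize τ ε σ))
      (Set.Icc 0 1) :=
    continuousOn_fidelity (hcont ρ).continuousOn (hcont σ).continuousOn
      (fun ε hε => (depolarize_isState hτ hρ hε.1 hε.2).1)
      (fun ε hε => (depolarize_isState hτ hσ hε.1 hε.2).1)
  have hF0 := (hF 0 (by simp)).mono_of_mem_nhdsWithin
    (Filter.mem_of_superset (Ioc_mem_nhdsGT zero_lt_one) Set.Ioc_subset_Icc_self)
  have hlim := (ENNReal.continuous_ofReal.comp Real.continuous_arccos).continuousAt.tendsto.comp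
    hF0.tendsto
  have h00 : ∀ A : Matrix n n ℂ, depolarize τ 0 A = A := fun A => by simp [depolarize]
  simp only [h00, Function.comp_apply] at hlim
  refine le_of_tendsto hlim ?_
  filter_upwards [Ioc_mem_nhdsGT zero_lt_one] with ε hε
  exact ofReal_arccos_fidelity_depolarize_le hγ hτ hτp hε.1 hε.2

theorem toReal_rldDist_le_pi_div_two {ρ σ : Matrix n n ℂ} (hρ : IsState ρ) (hσ : IsState σ) :
    (rldDist ρ σ).toReal ≤ Real.pi / 2 :=
  ENNReal.toReal_le_of_le_ofReal (by positivity) (rldDist_le_pi_div_two hρ hσ)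

theorem rldDist_ne_top {ρ σ : Matrix n n ℂ} (hρ : IsState ρ) (hσ : IsState σ) :
    rldDist ρ σ ≠ ⊤ :=
  ((rldDist_le_pi_div_two hρ hσ).trans_lt ENNReal.ofReal_lt_top).ne

theorem arccos_FR {ρ σ : Matrix n n ℂ} (hρ : IsState ρ) (hσ : IsState σ) :
    Real.arccos (FR ρ σ) = (rldDist ρ σ).toReal :=
  Real.arccos_cos ENNReal.toReal_nonneg
    ((toReal_rldDist_le_pi_div_two hρ hσ).trans (by linarith [Real.pi_pos]))

theorem FR_le_fidelity [DecidableEq n] {ρ σ : Matrix n n ℂ} (hρ : IsState ρ) (hσ : IsState σ) :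
    FR ρ σ ≤ fidelity ρ σ := by
  have h := ofReal_arccos_fidelity_le_rldDist hρ hσ
  rw [ENNReal.ofReal_le_iff_le_toReal (rldDist_ne_top hρ hσ)] at h
  -- This case split avoids proving `fidelity ≤ 1`, needed to invert `arccos`.
  rcases le_total (fidelity ρ σ) 1 with h1 | h1
  · rw [← Real.cos_arccos (by linarith [fidelity_nonneg ρ σ]) h1]
    exact Real.cos_le_cos_of_nonneg_of_le_pi (Real.arccos_nonneg _)
      ((toReal_rldDist_le_pi_div_two hρ hσ).trans (by linarith [Real.pi_pos])) h
  · exact (Real.cos_le_one _).trans h1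

theorem arccos_FR_triangle {ρ σ τ : Matrix n n ℂ} (hρ : IsState ρ) (hσ : IsState σ)
    (hτ : IsState τ) :
    Real.arccos (FR ρ σ) ≤ Real.arccos (FR ρ τ) + Real.arccos (FR τ σ) := by
  rw [arccos_FR hρ hσ, arccos_FR hρ hτ, arccos_FR hτ hσ,
    ← ENNReal.toReal_add (rldDist_ne_top hρ hτ) (rldDist_ne_top hτ hσ)]
  exact ENNReal.toReal_mono
    (ENNReal.add_ne_top.2 ⟨rldDist_ne_top hρ hτ, rldDist_ne_top hτ hσ⟩) (rldDist_triangle ρ τ σ)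

end LowerBound

/-! ### Reverse tests as preparations of states. -/

section ReverseTests

variable {X n : Type*} [Fintype X] [DecidableEq X] [Fintype n]

theorem map_diagState {ν : Type*} (Φ : Matrix X X ℂ →ₗ[ℂ] Matrix ν ν ℂ) (p : X → ℝ) :
    Φ (diagState p) = ∑ x, (p x : ℂ) • Φ (Matrix.single x x 1) := by
  have h : diagState p = ∑ x, (p x : ℂ) • Matrix.single x x (1 : ℂ) := by
    ext i j
    rcases eq_or_ne i j with rfl | hij
    · simp [diagState, Matrix.sum_apply, Matrix.single_apply]
    · have : ∀ x, ¬(x = i ∧ x = j) := fun x hx => hij (hx.1.symm.trans hx.2)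
      simp [diagState, Matrix.sum_apply, hij, this]
  rw [h, map_sum]
  simp only [map_smul]

theorem IsCPTP.isState_single {Φ : Matrix X X ℂ →ₗ[ℂ] Matrix n n ℂ} (hΦ : IsCPTP Φ) (x : X) :
    IsState (Φ (Matrix.single x x 1)) := by
  have hB : (Matrix.single x x (1 : ℂ)).PosSemidef := by
    rw [← Matrix.diagonal_single]
    refine Matrix.PosSemidef.diagonal fun y => ?_
    by_cases h : y = x
    · subst h; simp
    · simp [h]
  refine ⟨?_, by rw [hΦ.2]; simp⟩
  -- Positivity of `Φ` is the case `k = 1` of complete positivity.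
  exact (hΦ.1 1 _ (hB.submatrix Prod.fst)).submatrix fun i : n => (i, (0 : Fin 1))

theorem classicalFidelity_le_FR {Φ : Matrix X X ℂ →ₗ[ℂ] Matrix n n ℂ} {p q : X → ℝ}
    {ρ σ : Matrix n n ℂ} (h : IsReverseTest Φ p q ρ σ) : classicalFidelity p q ≤ FR ρ σ := by
  have hle := rldDist_mixture_le h.cptp.isState_single h.prob_left h.prob_right
  rw [← map_diagState, ← map_diagState, h.map_left, h.map_right] at hle
  have h2 := ENNReal.toReal_le_of_le_ofReal (Real.arccos_nonneg _) hle
  rw [← Real.cos_arccos (by linarith [classicalFidelity_nonneg p q])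
    (classicalFidelity_le_one h.prob_left h.prob_right)]
  exact Real.cos_le_cos_of_nonneg_of_le_pi ENNReal.toReal_nonneg (Real.arccos_le_pi _) h2

theorem Fmin_le_FR {ρ σ : Matrix n n ℂ} (hρ : IsState ρ) (hσ : IsState σ) :
    Fmin ρ σ ≤ FR ρ σ := by
  refine Real.sSup_le ?_ ?_
  · rintro _ ⟨k, Φ, p, q, h, rfl⟩
    exact classicalFidelity_le_FR h
  -- `Real.sSup_le` also covers an empty set, whose supremum is 0, so it asks for `0 ≤ FR`.
  · exact Real.cos_nonneg_of_neg_pi_div_two_le_of_le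
      ((neg_nonpos.2 (by positivity)).trans ENNReal.toReal_nonneg)
      (toReal_rldDist_le_pi_div_two hρ hσ)

/-- The channel preparing the matrix `S x` when the classical input is `x`. -/
def prepare {ν : Type*} (S : X → Matrix ν ν ℂ) : Matrix X X ℂ →ₗ[ℂ] Matrix ν ν ℂ where
  toFun A := ∑ x, A x x • S x
  map_add' A B := by simp [add_smul, Finset.sum_add_distrib]
  map_smul' c A := by simp [mul_smul, Finset.smul_sum]

theorem isCPTP_prepare {Y : Type*} [Fintype Y] {S : Y → Matrix n n ℂ} (hS : ∀ x, IsState (S x)) :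
    IsCPTP (prepare S) := by
  refine ⟨fun k A hA => ?_, fun A => ?_⟩
  -- Only the diagonal blocks of `A` survive, each tensored with the prepared state.
  · have h : ampliation (prepare S) k A = ∑ x, Matrix.kroneckerMap (· * ·) (S x)
        (A.submatrix (fun i : Fin k => (x, i)) fun i => (x, i)) := by
      ext i j
      simp [ampliation, prepare, Matrix.sum_apply, mul_comm]
    rw [h]
    exact Matrix.posSemidef_sum _ fun x _ => (hS x).1.kronecker (hA.submatrix _)
  · simp only [prepare, LinearMap.coe_mk, AddHom.coe_mk, Matrix.trace_sum, Matrix.trace_smul,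
      (hS _).2, smul_eq_mul, mul_one]
    rfl

theorem prepare_diagState {ν : Type*} (S : X → Matrix ν ν ℂ) (p : X → ℝ) :
    prepare S (diagState p) = ∑ x, (p x : ℂ) • S x := by
  simp [prepare, diagState]

theorem classicalFidelity_le_Fmin {k : ℕ} {S : Fin k → Matrix n n ℂ} (hS : ∀ x, IsState (S x))
    {p q : Fin k → ℝ} (hp : p ∈ stdSimplex ℝ (Fin k)) (hq : q ∈ stdSimplex ℝ (Fin k)) :
    classicalFidelity p q ≤ Fmin (∑ x, (p x : ℂ) • S x) (∑ x, (q x : ℂ) • S x) := by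
  refine le_csSup ⟨1, ?_⟩ ⟨k, prepare S, p, q, ⟨isCPTP_prepare hS, hp, hq, prepare_diagState S p,
    prepare_diagState S q⟩, rfl⟩
  rintro _ ⟨k, Φ, p, q, h, rfl⟩
  exact classicalFidelity_le_one h.prob_left h.prob_right

/-- `Fmin` vanishes for two states whose kernels together span the whole space. -/
theorem Fmin_nonpos_of_forall_eq_zero {ρ σ : Matrix n n ℂ}
    (h : ∀ T : Matrix n n ℂ, (∀ v, ρ.mulVec v = 0 → T.mulVec v = 0) →
      (∀ v, σ.mulVec v = 0 → T.mulVec v = 0) → T = 0) : Fmin ρ σ ≤ 0 := by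
  refine Real.sSup_le ?_ le_rfl
  rintro _ ⟨k, Φ, p, q, hΦ, rfl⟩
  have hker : ∀ {r : Fin k → ℝ} {χ : Matrix n n ℂ}, r ∈ stdSimplex ℝ (Fin k) →
      Φ (diagState r) = χ → ∀ x, r x ≠ 0 → ∀ v, χ.mulVec v = 0 →
      (Φ (Matrix.single x x 1)).mulVec v = 0 := by
    intro r χ hr hχ x hx v hv
    rw [← hχ, map_diagState] at hv
    have h1 := mulVec_eq_zero_of_sum_mulVec_eq_zero
      (fun y => (hΦ.cptp.isState_single y).1.smul (by exact_mod_cast hr.1 y)) hv x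
    rw [Matrix.smul_mulVec] at h1
    exact (smul_eq_zero.1 h1).resolve_left (by exact_mod_cast hx)
  refine le_of_eq (Finset.sum_eq_zero fun x _ => ?_)
  by_cases hp : p x = 0
  · simp [hp]
  by_cases hq : q x = 0
  · simp [hq]
  have h0 := h _ (hker hΦ.prob_left hΦ.map_left x hp) (hker hΦ.prob_right hΦ.map_right x hq)
  have h1 := (hΦ.cptp.isState_single x).2
  rw [h0] at h1
  simp at h1

end ReverseTests

/-! ### Failure of the triangle inequality for `Fmin`. -/

section Counterexample

variable {m : ℕ}

/-- The pure state on the first two coordinates in the direction of the real vector `(a, b)`. -/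
noncomputable def pureState (m : ℕ) (a b : ℝ) : Matrix (Fin (m + 2)) (Fin (m + 2)) ℂ :=
  (((a ^ 2 + b ^ 2)⁻¹ : ℝ) : ℂ) • Matrix.vecMulVec
    ((a : ℂ) • Pi.single 0 1 + (b : ℂ) • Pi.single 1 1)
    (star ((a : ℂ) • Pi.single 0 1 + (b : ℂ) • Pi.single 1 1))

theorem pureState_isState {a b : ℝ} (h : a ^ 2 + b ^ 2 ≠ 0) : IsState (pureState m a b) := by
  refine ⟨(Matrix.posSemidef_vecMulVec_self_star _).smul (by
    exact_mod_cast inv_nonneg.2 (by positivity)), ?_⟩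
  have h' : ((a : ℂ) ^ 2 + (b : ℂ) ^ 2) ≠ 0 := by exact_mod_cast h
  simp only [pureState, Matrix.trace_smul, Matrix.trace_vecMulVec, star_add, star_smul,
    smul_eq_mul, Pi.star_single, star_one, dotProduct_add, dotProduct_smul, dotProduct_single,
    Pi.add_apply, Pi.smul_apply, Pi.single_eq_same, Complex.star_def, Complex.conj_ofReal]
  push_cast
  simp
  field_simp

theorem pureState_mulVec_eq_zero (a b : ℝ) {v : Fin (m + 2) → ℂ}
    (h : (a : ℂ) * v 0 + (b : ℂ) * v 1 = 0) : (pureState m a b).mulVec v = 0 := by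
  rw [pureState, Matrix.smul_mulVec, Matrix.vecMulVec_mulVec]
  simp [h]

theorem eq_zero_of_pureState_kernels {T : Matrix (Fin (m + 2)) (Fin (m + 2)) ℂ}
    (h1 : ∀ v, (pureState m 4 3).mulVec v = 0 → T.mulVec v = 0)
    (h2 : ∀ v, (pureState m 4 (-3)).mulVec v = 0 → T.mulVec v = 0) : T = 0 := by
  have key : ∀ v : Fin (m + 2) → ℂ, T.mulVec v = 0 := by
    intro v
    -- `u` and `w'` are orthogonal to `(4, 3)`, and `w` to `(4, -3)`. Since `w - w' = 8e` and `v -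
    -- u` is a multiple of `e`, the kernels span the space.
    set u : Fin (m + 2) → ℂ := Function.update v 1 (-(4 / 3) * v 0) with hu
    set e : Fin (m + 2) → ℂ := Pi.single 1 1 with he
    set w : Fin (m + 2) → ℂ := Pi.single 0 3 + Pi.single 1 4 with hw
    set w' : Fin (m + 2) → ℂ := Pi.single 0 3 + Pi.single 1 (-4) with hw'
    have hTu : T.mulVec u = 0 := h1 u (pureState_mulVec_eq_zero _ _ (by
      simp [hu]; ring))
    have hTw : T.mulVec w = 0 := h2 w (pureState_mulVec_eq_zero _ _ (by
      simp [hw]; ring))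
    have hTw' : T.mulVec w' = 0 := h1 w' (pureState_mulVec_eq_zero _ _ (by
      simp [hw']; ring))
    have hwe : w = w' + (8 : ℂ) • e := by
      ext i
      simp only [hw, hw', he, Pi.add_apply, Pi.smul_apply, Pi.single_apply]
      split_ifs <;> norm_num
    have hTe : T.mulVec e = 0 := by
      rw [hwe, Matrix.mulVec_add, hTw', zero_add, Matrix.mulVec_smul] at hTw
      exact (smul_eq_zero.1 hTw).resolve_left (by norm_num)
    have hv : v = u + (v 1 + 4 / 3 * v 0) • e := by
      ext i
      by_cases hi : i = 1
      · subst hi; simp [hu, he]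
      · simp [hu, he, hi]
    rw [hv, Matrix.mulVec_add, Matrix.mulVec_smul, hTu, hTe, smul_zero, add_zero]
  exact Matrix.ext_of_mulVec_single fun i => by rw [key, Matrix.zero_mulVec]

/-- The off-diagonal entries `±12/49` cancel, so both sides are `diag (4/7, 3/7, 0, …)`. -/
theorem mixture_pureState_eq :
    ((25 / 49 : ℝ) : ℂ) • pureState m 4 3 + ((24 / 49 : ℝ) : ℂ) • pureState m 1 (-1) =
      ((25 / 49 : ℝ) : ℂ) • pureState m 4 (-3) + ((24 / 49 : ℝ) : ℂ) • pureState m 1 1 := by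
  ext i j
  simp only [pureState, Matrix.add_apply, Matrix.smul_apply, Matrix.vecMulVec_apply, Pi.add_apply,
    Pi.smul_apply, Pi.star_apply, star_add, star_smul, smul_eq_mul, Pi.single_apply]
  split_ifs <;> norm_num

theorem five_sevenths_le_Fmin {ρ χ : Matrix (Fin (m + 2)) (Fin (m + 2)) ℂ} (hρ : IsState ρ)
    (hχ : IsState χ) :
    5 / 7 ≤ Fmin ρ (((25 / 49 : ℝ) : ℂ) • ρ + ((24 / 49 : ℝ) : ℂ) • χ) ∧
      5 / 7 ≤ Fmin (((25 / 49 : ℝ) : ℂ) • ρ + ((24 / 49 : ℝ) : ℂ) • χ) ρ := by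
  have hS : ∀ x, IsState ((![ρ, χ] : Fin 2 → _) x) := fun x => by fin_cases x <;> simpa
  have hp : (![1, 0] : Fin 2 → ℝ) ∈ stdSimplex ℝ (Fin 2) :=
    ⟨fun x => by fin_cases x <;> simp, by simp⟩
  have hq : (![25 / 49, 24 / 49] : Fin 2 → ℝ) ∈ stdSimplex ℝ (Fin 2) :=
    ⟨fun x => by fin_cases x <;> norm_num, by norm_num⟩
  have hs : √(25 / 49 : ℝ) = 5 / 7 := by
    rw [show (25 / 49 : ℝ) = (5 / 7) ^ 2 by norm_num, Real.sqrt_sq (by norm_num)]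
  have h1 := classicalFidelity_le_Fmin hS hp hq
  have h2 := classicalFidelity_le_Fmin hS hq hp
  simp only [classicalFidelity, Fin.sum_univ_two, Matrix.cons_val_zero, Matrix.cons_val_one, hs,
    Real.sqrt_one, Real.sqrt_zero, Complex.ofReal_one, Complex.ofReal_zero, one_smul, zero_smul,
    add_zero, one_mul, mul_one, mul_zero, zero_mul] at h1 h2
  exact ⟨h1, h2⟩

theorem exists_arccos_Fmin_lt (d : ℕ) (hd : 2 ≤ d) :
    ∃ ρ σ τ : Matrix (Fin d) (Fin d) ℂ, IsState ρ ∧ IsState σ ∧ IsState τ ∧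
      Real.arccos (Fmin ρ τ) + Real.arccos (Fmin τ σ) < Real.arccos (Fmin ρ σ) := by
  obtain ⟨m, rfl⟩ := Nat.exists_eq_add_of_le' hd
  have hρ : IsState (pureState m 4 3) := pureState_isState (by norm_num)
  have hσ : IsState (pureState m 4 (-3)) := pureState_isState (by norm_num)
  have hχ : IsState (pureState m 1 (-1)) := pureState_isState (by norm_num)
  have hχ' : IsState (pureState m 1 1) := pureState_isState (by norm_num)
  have hτ : IsState (((25 / 49 : ℝ) : ℂ) • pureState m 4 3 +
      ((24 / 49 : ℝ) : ℂ) • pureState m 1 (-1)) := by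
    have h := isState_sum (S := ![pureState m 4 3, pureState m 1 (-1)])
      (p := ![25 / 49, 24 / 49]) (fun x => by fin_cases x <;> simpa)
      (fun x => by fin_cases x <;> norm_num) (by norm_num)
    simpa only [Fin.sum_univ_two, Matrix.cons_val_zero, Matrix.cons_val_one] using h
  refine ⟨_, _, _, hρ, hσ, hτ, ?_⟩
  have h1 := (five_sevenths_le_Fmin hρ hχ).1
  have h2 := (five_sevenths_le_Fmin hσ hχ').2
  rw [← mixture_pureState_eq] at h2
  have h3 : Fmin (pureState m 4 3) (pureState m 4 (-3)) ≤ 0 :=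
    Fmin_nonpos_of_forall_eq_zero fun T => eq_zero_of_pureState_kernels
  have hquarter : Real.arccos (5 / 7) < Real.pi / 4 := by
    -- The weight `25/49` exceeds `1/2`, so two such angles add up to less than `π / 2 = arccos 0`.
    have hs : √2 / 2 < (5 / 7 : ℝ) := by
      nlinarith [Real.sq_sqrt (show (0 : ℝ) ≤ 2 by norm_num), Real.sqrt_nonneg 2]
    have hpi : Real.arccos (√2 / 2) = Real.pi / 4 := by
      rw [← Real.cos_pi_div_four, Real.arccos_cos (by positivity) (by linarith [Real.pi_pos])]
    rw [← hpi]
    exact Real.arccos_lt_arccos (by linarith [Real.sqrt_nonneg 2]) hs (by norm_num)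
  have h4 := Real.arccos_le_arccos h1
  have h5 := Real.arccos_le_arccos h2
  have h6 := Real.arccos_le_arccos h3
  rw [Real.arccos_zero] at h6
  linarith

end Counterexample

end QFidelity

theorem mainTheorem8 (d : ℕ) :
    (∀ ρ σ : Matrix (Fin d) (Fin d) ℂ, QFidelity.IsState ρ → QFidelity.IsState σ →
      QFidelity.rldDist ρ σ ≠ ⊤ ∧
      QFidelity.Fmin ρ σ ≤ QFidelity.FR ρ σ ∧
      QFidelity.FR ρ σ ≤ QFidelity.fidelity ρ σ) ∧
    (∀ ρ σ τ : Matrix (Fin d) (Fin d) ℂ,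
      QFidelity.IsState ρ → QFidelity.IsState σ → QFidelity.IsState τ →
      Real.arccos (QFidelity.FR ρ σ) ≤
        Real.arccos (QFidelity.FR ρ τ) + Real.arccos (QFidelity.FR τ σ)) ∧
    (2 ≤ d →
      (∃ ρ σ τ : Matrix (Fin d) (Fin d) ℂ,
        QFidelity.IsState ρ ∧ QFidelity.IsState σ ∧ QFidelity.IsState τ ∧
        Real.arccos (QFidelity.Fmin ρ τ) + Real.arccos (QFidelity.Fmin τ σ) <
          Real.arccos (QFidelity.Fmin ρ σ)) ∧
      (∃ ρ σ : Matrix (Fin d) (Fin d) ℂ,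
        QFidelity.IsState ρ ∧ QFidelity.IsState σ ∧
        QFidelity.Fmin ρ σ ≠ QFidelity.FR ρ σ)) := by
  refine ⟨fun ρ σ hρ hσ => ⟨QFidelity.rldDist_ne_top hρ hσ, QFidelity.Fmin_le_FR hρ hσ,
    QFidelity.FR_le_fidelity hρ hσ⟩,
    fun ρ σ τ hρ hσ hτ => QFidelity.arccos_FR_triangle hρ hσ hτ, fun hd => ?_⟩
  have hlt := QFidelity.exists_arccos_Fmin_lt d hd
  refine ⟨hlt, ?_⟩
  by_contra! heq
  obtain ⟨ρ, σ, τ, hρ, hσ, hτ, h⟩ := hlt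
  rw [heq ρ τ hρ hτ, heq τ σ hτ hσ, heq ρ σ hρ hσ] at h
  exact absurd (QFidelity.arccos_FR_triangle hρ hσ hτ) (not_le.2 h)
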